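/- Let $m,n,d\in\mathbb{N}$ with $n,d\ge 1$, let $\alpha=(\alpha_1\ge\dots\ge\alpha_m)$ be a non-increasing sequence of non-negative weights, and let $A\in\mathcal{M}_d(\mathbb{C})$ be positive semidefinite with eigenvalues $\lambda=(\lambda_1\ge\dots\ge\lambda_d)$, counted with multiplicity. Let $\|\cdot\|_2$ be the Frobenius norm. Let $\Lambda_\alpha$ be the set of all G-Bessel sequences $\mathcal{F}=(T_i)_{i=1}^m$ of operators $T_i:\mathbb{C}^d\to\mathbb{C}^n$ (that is, $\sum_i\|T_ix\|^2\le b\|x\|^2$ for all $x$, for some constant $b>0$) with $\|T_i\|_2^2=\alpha_i$ for every $i$, and let $S_{\mathcal F}=\sum_iT_i^*T_i$. Put $N=mn$ and let $w=(w_1,\dots,w_N)=(\frac{\alpha_1}{n}\mathbb{1}_n,\dots,\frac{\alpha_m}{n}\mathbb{1}_n)$, each $\frac{\alpha_i}{n}$ being repeated $n$ times. For $f=(f_1,\dots,f_N)\in(\mathbb{C}^d)^N$ let $S_f=\sum_kf_k\otimes f_k$, where $(x\otimes y)z=\langle z,y\rangle x$. The classical (vector) problem is to minimize $\|A-S_f\|_2$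 over all $f$ with $\|f_k\|^2=w_k$ for $k=1,\dots,N$. Write $x\prec y$ for real vectors $x\in\mathbb{R}^k$, $y\in\mathbb{R}^l$ if they have the same sum and, for every $j\le\min(k,l)$, the sum of the $j$ largest entries of $x$ is at most that of $y$. Then: 1. There is $\mathcal{F}^{\rm op}\in\Lambda_\alpha$ with $\|A-S_{\mathcal{F}^{\rm op}}\|_2\le\|A-S_{\mathcal F}\|_2$ for all $\mathcal{F}\in\Lambda_\alpha$. 2. The minimum of the classical problem is attained and equals $\min_{\mathcal{F}\in\Lambda_\alpha}\|A-S_{\mathcal F}\|_2$. 3. If $f$ is a minimizer of the classical problem, split into $m$ consecutive blocks $(f_{i,1},\dots,f_{i,n})$, $i=1,\dots,m$, then the operators $T_ix=(\langle x,f_{i,j}\rangle)_{j=1}^n$ form a minimizer in $\Lambda_\alpha$, with frame operator $S_f$. Moreover $\mathcal{F}\in\Lambda_\alpha$ is a minimizer if and only if $S_{\mathcal F}=S_f$ for some minimizer $f$ of the classical problem. 4. Let $r=\min(d,N)$. There is exactly one $\delta\in\mathbb{R}^d$ for which there are indices $0=i_0<i_1<\dots<i_p=r$ and constants $b_1<\dots<b_p$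 such that $\delta_i=\min(b_k,\lambda_i)$ for $i_{k-1}<i\le i_k$ and $1\le k\le p$, $\delta_i=\lambda_i$ for $i>r$, and $$(w_i)_{i=i_{k-1}+1}^{i_k}\prec\big((\lambda_i-b_k)^+\big)_{i=i_{k-1}+1}^{i_k}\quad(1\le k<p),\qquad (w_i)_{i=i_{p-1}+1}^{N}\prec\big((\lambda_i-b_p)^+\big)_{i=i_{p-1}+1}^{r}$$ (the conditions on blocks are void if $r=0$). For this $\delta$, determined by $\lambda$ and $w$ only, $\min_{\mathcal{F}\in\Lambda_\alpha}\|A-S_{\mathcal F}\|_2=\big(\sum_{i=1}^d\delta_i^2\big)^{1/2}$, and $\mathcal{F}\in\Lambda_\alpha$ is a minimizer if and only if there is an orthonormal basis $(v_i)_{i=1}^d$ of $\mathbb{C}^d$ with $A=\sum_i\lambda_i\,v_i\otimes v_i$ and $S_{\mathcal F}=\sum_i(\lambda_i-\delta_i)\,v_i\otimes v_i$. -/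

import Mathlib

open scoped Matrix ComplexOrder

-- Throughout, the norm of a matrix is its Frobenius (Hilbert-Schmidt) norm.
attribute [local instance] Matrix.frobeniusNormedAddCommGroup

namespace GFrame

noncomputable section

/-- The rank-one matrix `x ⊗ y`, i.e. the matrix of `z ↦ ⟨z, y⟩ x` (linear in `z`). -/
def rankOne {d : ℕ} (x y : EuclideanSpace ℂ (Fin d)) : Matrix (Fin d) (Fin d) ℂ :=
  Matrix.of fun a b => x a * star (y b)

/-! ### Operator-valued (G-)Bessel sequences -/

/-- `T = (T_1, …, T_m)`, operators from `ℂ^d` to `ℂ^n` given by their matrices, is a G-Bessel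
sequence: `∑ ‖T_i x‖² ≤ b ‖x‖²` for some constant `b > 0`. -/
def IsGBessel {m n d : ℕ} (T : Fin m → Matrix (Fin n) (Fin d) ℂ) : Prop :=
  ∃ b : ℝ, 0 < b ∧ ∀ x : EuclideanSpace ℂ (Fin d),
    ∑ i, ‖Matrix.toEuclideanLin (T i) x‖ ^ 2 ≤ b * ‖x‖ ^ 2

/-- The frame operator `∑ T_i^* T_i`. -/
def gFrameOp {m n d : ℕ} (T : Fin m → Matrix (Fin n) (Fin d) ℂ) : Matrix (Fin d) (Fin d) ℂ :=
  ∑ i, (T i)ᴴ * T i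

/-- `Λ_α`: the G-Bessel sequences for `ℂ^d`, with analysis space `ℂ^n`, with `‖T_i‖₂² = α_i`. -/
def gSet {m : ℕ} (n d : ℕ) (α : Fin m → ℝ) : Set (Fin m → Matrix (Fin n) (Fin d) ℂ) :=
  {T | IsGBessel T ∧ ∀ i, ‖T i‖ ^ 2 = α i}

/-- `T` minimizes `‖A - S_T‖₂` over `Λ_α`. -/
def IsOptG {m n d : ℕ} (A : Matrix (Fin d) (Fin d) ℂ) (α : Fin m → ℝ)
    (T : Fin m → Matrix (Fin n) (Fin d) ℂ) : Prop :=
  T ∈ gSet n d α ∧ ∀ T' ∈ gSet n d α, ‖A - gFrameOp T‖ ≤ ‖A - gFrameOp T'‖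

/-! ### The classical problem for sequences of vectors -/

/-- The frame operator `∑ f_k ⊗ f_k`. -/
def vecFrameOp {N d : ℕ} (f : Fin N → EuclideanSpace ℂ (Fin d)) : Matrix (Fin d) (Fin d) ℂ :=
  ∑ k, rankOne (f k) (f k)

/-- The sequences of `N` vectors of `ℂ^d` with `‖f_k‖² = w_k`. -/
def vecSet {N : ℕ} (d : ℕ) (w : Fin N → ℝ) : Set (Fin N → EuclideanSpace ℂ (Fin d)) :=
  {f | ∀ k, ‖f k‖ ^ 2 = w k}

/-- `f` minimizes `‖A - S_f‖₂` among the sequences with `‖f_k‖² = w_k`. -/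
def IsOptVec {N d : ℕ} (A : Matrix (Fin d) (Fin d) ℂ) (w : Fin N → ℝ)
    (f : Fin N → EuclideanSpace ℂ (Fin d)) : Prop :=
  f ∈ vecSet d w ∧ ∀ f' ∈ vecSet d w, ‖A - vecFrameOp f‖ ≤ ‖A - vecFrameOp f'‖

/-- The weights `(α_1/n, …, α_1/n, α_2/n, …, α_2/n, …, α_m/n, …, α_m/n)`, each `n` times. -/
def splitWeights {m : ℕ} (n : ℕ) (α : Fin m → ℝ) : Fin (m * n) → ℝ :=
  fun k => α (finProdFinEquiv.symm k).1 / n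

/-- The G-sequence made of a sequence of `m * n` vectors: `T_i x` has coordinates
`⟨x, f_{(i,1)}⟩, …, ⟨x, f_{(i,n)}⟩`, where `f_{(i,1)}, …, f_{(i,n)}` is the `i`-th block of
`n` consecutive vectors. -/
def gOfVec {m n d : ℕ} (f : Fin (m * n) → EuclideanSpace ℂ (Fin d)) :
    Fin m → Matrix (Fin n) (Fin d) ℂ :=
  fun i => Matrix.of fun j a => star (f (finProdFinEquiv (i, j)) a)

/-! ### Spectral solution of the classical problem -/

/-- `λ(A)`: the eigenvalues of `A` with multiplicity, in non-increasing order. -/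
def spec {d : ℕ} {A : Matrix (Fin d) (Fin d) ℂ} (hA : A.PosSemidef) : Fin d → ℝ :=
  fun i => hA.isHermitian.eigenvalues₀ (Fin.cast (Fintype.card_fin d).symm i)

/-- The sum of the `j` largest entries of the family `(x_i)_{i ∈ s}`. -/
def topSum {ι : Type*} (s : Finset ι) (x : ι → ℝ) (j : ℕ) : ℝ :=
  (((s.val.map x).sort (· ≥ ·)).take j).sum

/-- Majorization `(x_i)_{i ∈ s} ≺ (y_i)_{i ∈ t}` of families of possibly different sizes. -/
def Majorized {ι κ : Type*} (s : Finset ι) (x : ι → ℝ) (t : Finset κ) (y : κ → ℝ) : Prop :=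
  (∀ j ≤ min s.card t.card, topSum s x j ≤ topSum t y j) ∧ ∑ i ∈ s, x i = ∑ i ∈ t, y i

/-- The indices `i` of a vector of length `N` with `a ≤ i < b` (counting from `0`). -/
def block (N a b : ℕ) : Finset (Fin N) :=
  Finset.univ.filter fun i => a ≤ i.val ∧ i.val < b

/-- `δ` is the vector built from the non-increasing data `l` (length `d`) and `w` (length `N`):
with `r = min d N`, there are indices `0 = e_0 < e_1 < ⋯ < e_p = r` and constants
`c_1 < ⋯ < c_p` such that in every block `e_{k-1} ≤ i < e_k` one has
`(w_i) ≺ ((l_i - c_k)⁺)` and `δ_i = min (c_k, l_i)`; in the last block, `w` runs over all its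
remaining entries.  If `N < d`, the last `d - N` entries of `δ` are those of `l`. -/
def IsSpectralDiff {d N : ℕ} (l : Fin d → ℝ) (w : Fin N → ℝ) (δ : Fin d → ℝ) : Prop :=
  ∃ (p : ℕ) (e : Fin (p + 1) → ℕ) (c : Fin p → ℝ),
    e 0 = 0 ∧ StrictMono e ∧ e (Fin.last p) = min d N ∧ StrictMono c ∧
    (∀ k : Fin p,
      Majorized (block N (e k.castSucc) (if k.succ = Fin.last p then N else e k.succ)) w
        (block d (e k.castSucc) (e k.succ)) (fun i => max (l i - c k) 0)) ∧
    (∀ k : Fin p, ∀ i ∈ block d (e k.castSucc) (e k.succ), δ i = min (c k) (l i)) ∧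
    (∀ i : Fin d, min d N ≤ i.val → δ i = l i)

end

end GFrame

/-! The two problems have the same set of frame operators. The conjugated rows of `T_i` are `n`
vectors with frame operator `T_i^* T_i` and total squared norm `α_i`. Rotating two vectors in their
plane, `(x, y) ↦ (cx + sy, -sx + cy)`, does not change the frame operator, and enough rotations make
all `n` norms equal. Conversely, blocks of vectors are the rows of operators
(`exists_vecFrameOp_eq_gFrameOp`, `gFrameOp_gOfVec`).

For vectors, call `ν` admissible if it is non-negative, has the same total as `w`, and its prefix
sums dominate those of `w`. Ky Fan's inequality on the span of the first `j` vectors shows that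
ordered spectra of frame operators are admissible (`isAdmissible_of_vecFrameOp`). Conversely,
rotations starting from scaled eigenvectors realize every admissible spectrum in every orthonormal
basis (`exists_vecFrameOp_eq`).

By `spectral_distance`, `‖A - S‖²` is at least the squared distance of the ordered spectra, with
equality only for a common ordered eigenbasis. What remains is to project `λ` onto the convex set of
admissible vectors. The projection is `λ - δ`: summation by parts over the blocks gives `∑ δ_i (ν_i
- (λ_i - δ_i)) ≤ 0` for every admissible `ν` (`IsSpectralDiff.optimal`). This yields the minimum,
the uniqueness of `δ` and the equality case. The blocks themselves come from raising a water level
until a constraint becomes tight, then restarting after the last tight index. -/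

namespace GFrame

open Finset

/-! ### Water-filling block data -/

/-- The extension by zero of a finite real vector to `ℕ`. -/
noncomputable def zeroExt {N : ℕ} (x : Fin N → ℝ) : ℕ → ℝ :=
  fun i => if h : i < N then x ⟨i, h⟩ else 0

theorem zeroExt_of_lt {N : ℕ} (x : Fin N → ℝ) {i : ℕ} (h : i < N) : zeroExt x i = x ⟨i, h⟩ := by
  simp [zeroExt, h]

theorem zeroExt_of_le {N : ℕ} (x : Fin N → ℝ) {i : ℕ} (h : N ≤ i) : zeroExt x i = 0 := by
  simp [zeroExt, not_lt.mpr h]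

@[simp] theorem zeroExt_val {N : ℕ} (x : Fin N → ℝ) (i : Fin N) : zeroExt x i = x i := by
  simp [zeroExt]

theorem zeroExt_nonneg {N : ℕ} {x : Fin N → ℝ} (hx : ∀ i, 0 ≤ x i) (i : ℕ) : 0 ≤ zeroExt x i := by
  unfold zeroExt
  split_ifs
  exacts [hx _, le_rfl]

theorem zeroExt_antitone {N : ℕ} {x : Fin N → ℝ} (hx : ∀ i, 0 ≤ x i) (hx' : Antitone x) :
    Antitone (zeroExt x) := by
  intro i j hij
  by_cases hj : j < N
  · rw [zeroExt_of_lt x hj, zeroExt_of_lt x (hij.trans_lt hj)]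
    exact hx' hij
  · rw [zeroExt_of_le x (not_lt.mp hj)]
    exact zeroExt_nonneg hx i

theorem sum_univ_eq_sum_range_zeroExt {N : ℕ} (x : Fin N → ℝ) :
    ∑ i, x i = ∑ i ∈ range N, zeroExt x i := by
  rw [← Fin.sum_univ_eq_sum_range]
  simp

/-- The block conditions of the spectral solution, for sequences indexed by `ℕ`. -/
def IsWaterFilling (l w : ℕ → ℝ) (N : ℕ) {p : ℕ} (e : Fin (p + 1) → ℕ) (c : Fin p → ℝ) : Prop :=
  ∀ k : Fin p,
    (∀ j, e k.castSucc ≤ j → j ≤ e k.succ →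
      ∑ i ∈ Ico (e k.castSucc) j, w i ≤ ∑ i ∈ Ico (e k.castSucc) j, max (l i - c k) 0) ∧
    ∑ i ∈ Ico (e k.castSucc) (if k.succ = Fin.last p then N else e k.succ), w i =
      ∑ i ∈ Ico (e k.castSucc) (e k.succ), max (l i - c k) 0

section Optimality

variable {l w δ : ℕ → ℝ} {N p : ℕ} {e : Fin (p + 1) → ℕ} {c : Fin p → ℝ}

theorem sub_min_eq_max (a b : ℝ) : a - min b a = max (a - b) 0 := by
  rcases le_total a b with h | h
  · rw [min_eq_right h, max_eq_right (by linarith), sub_self]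
  · rw [min_eq_left h, max_eq_left (by linarith)]

theorem IsWaterFilling.sum_block (hδ : ∀ k : Fin p, ∀ i, e k.castSucc ≤ i → i < e k.succ →
      δ i = min (c k) (l i)) (k : Fin p) {j : ℕ} (hj : j ≤ e k.succ) :
    ∑ i ∈ Ico (e k.castSucc) j, (l i - δ i) =
      ∑ i ∈ Ico (e k.castSucc) j, max (l i - c k) 0 := by
  refine sum_congr rfl fun i hi => ?_
  rw [mem_Ico] at hi
  rw [hδ k i hi.1 (hi.2.trans_le hj), sub_min_eq_max]

/-- Block totals telescope. The last block absorbs all the remaining weights, so at the last index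
the weights are summed up to `N`; with no block at all this says that the whole of `w` sums to zero,
hence `hN`. -/
theorem IsWaterFilling.prefix_eq (h : IsWaterFilling l w N e c) (he0 : e 0 = 0)
    (he : StrictMono e) (heN : e (Fin.last p) ≤ N) (hN : p = 0 → N = 0)
    (hδ : ∀ k : Fin p, ∀ i, e k.castSucc ≤ i → i < e k.succ → δ i = min (c k) (l i))
    (k : Fin (p + 1)) :
    ∑ i ∈ range (e k), (l i - δ i) = ∑ i ∈ range (if k = Fin.last p then N else e k), w i := by
  induction k using Fin.induction with
  | zero =>
    split_ifs with h0
    · have : p = 0 := by simpa [Fin.ext_iff] using h0.symm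
      simp [he0, hN this]
    · simp [he0]
  | succ k ih =>
    have hk : k.castSucc ≠ Fin.last p := (Fin.castSucc_lt_last k).ne
    rw [if_neg hk] at ih
    have hlt : e k.castSucc ≤ e k.succ := (he (Fin.castSucc_lt_succ (i := k))).le
    rw [← sum_range_add_sum_Ico _ hlt, ih, IsWaterFilling.sum_block hδ k le_rfl, ← (h k).2,
      sum_range_add_sum_Ico]
    split_ifs with h1
    · exact (he.monotone (Fin.le_last _)).trans heN
    · exact hlt

theorem IsWaterFilling.prefix_le (h : IsWaterFilling l w N e c) (he0 : e 0 = 0)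
    (he : StrictMono e) (heN : e (Fin.last p) ≤ N) (hN : p = 0 → N = 0)
    (hδ : ∀ k : Fin p, ∀ i, e k.castSucc ≤ i → i < e k.succ → δ i = min (c k) (l i))
    (k : Fin (p + 1)) :
    ∀ j ≤ e k, ∑ i ∈ range j, w i ≤ ∑ i ∈ range j, (l i - δ i) := by
  induction k using Fin.induction with
  | zero =>
    intro j hj
    obtain rfl : j = 0 := by omega
    simp
  | succ k ih =>
    intro j hj
    rcases le_total j (e k.castSucc) with h1 | h1
    · exact ih j h1
    · have hp := h.prefix_eq he0 he heN hN hδ k.castSucc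
      rw [if_neg (Fin.castSucc_lt_last k).ne] at hp
      rw [← sum_range_add_sum_Ico _ h1, ← sum_range_add_sum_Ico _ h1, hp,
        IsWaterFilling.sum_block hδ k hj]
      exact add_le_add le_rfl ((h k).1 j h1 hj)

/-- Summation by parts over blocks. In block `k`, `δ_i` may be replaced by `c k`: either they agree,
or `l i - δ i = 0`, `δ i ≤ c k` and `ν i ≥ 0`. The excess of `ν` at the end of a block is
non-negative, so the factor can grow from one level to the next. -/
theorem IsWaterFilling.sum_mul_le (h : IsWaterFilling l w N e c) (he0 : e 0 = 0)
    (he : StrictMono e) (heN : e (Fin.last p) ≤ N) (hN : p = 0 → N = 0) (hc : StrictMono c)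
    (hδ : ∀ k : Fin p, ∀ i, e k.castSucc ≤ i → i < e k.succ → δ i = min (c k) (l i))
    {ν : ℕ → ℝ} (hν : ∀ i, 0 ≤ ν i)
    (hνw : ∀ j, ∑ i ∈ range j, w i ≤ ∑ i ∈ range j, ν i)
    (hνN : ∑ i ∈ range (e (Fin.last p)), ν i = ∑ i ∈ range N, w i)
    (k : Fin (p + 1)) :
    ∀ C : ℝ, (∀ k' : Fin p, k'.castSucc < k → c k' ≤ C) →
      ∑ i ∈ range (e k), δ i * (ν i - (l i - δ i)) ≤
        C * (∑ i ∈ range (e k), ν i - ∑ i ∈ range (e k), (l i - δ i)) := by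
  induction k using Fin.induction with
  | zero =>
    intro C _
    simp [he0]
  | succ k ih =>
    intro C hC
    have hlt : e k.castSucc ≤ e k.succ := (he (Fin.castSucc_lt_succ (i := k))).le
    have h1 := ih (c k) fun k' hk' => hc.monotone (Fin.castSucc_lt_castSucc_iff.mp hk').le
    have h2 : ∑ i ∈ Ico (e k.castSucc) (e k.succ), δ i * (ν i - (l i - δ i)) ≤
        ∑ i ∈ Ico (e k.castSucc) (e k.succ), c k * (ν i - (l i - δ i)) := by
      refine sum_le_sum fun i hi => ?_
      rw [mem_Ico] at hi
      rw [hδ k i hi.1 hi.2]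
      rcases le_total (c k) (l i) with h3 | h3
      · rw [min_eq_left h3]
      · rw [min_eq_right h3, sub_self, sub_zero]
        exact mul_le_mul_of_nonneg_right h3 (hν i)
    rw [← mul_sum, sum_sub_distrib] at h2
    have h3 : 0 ≤ ∑ i ∈ range (e k.succ), ν i - ∑ i ∈ range (e k.succ), (l i - δ i) := by
      rw [h.prefix_eq he0 he heN hN hδ]
      split_ifs with h4
      · rw [h4, hνN, sub_self]
      · exact sub_nonneg.mpr (hνw _)
    have h4 : c k ≤ C := hC k (Fin.castSucc_lt_succ (i := k))
    have h5 := mul_le_mul_of_nonneg_right h4 h3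
    refine le_trans ?_ h5
    rw [← sum_range_add_sum_Ico (fun i => δ i * (ν i - (l i - δ i))) hlt,
      ← sum_range_add_sum_Ico ν hlt, ← sum_range_add_sum_Ico (fun i => l i - δ i) hlt]
    linarith

end Optimality

/-! ### Existence of the block data -/

/-- The next level is the highest one at which every demand `ω j - W` is still met, and the block
ends at the last tight index. Beyond it the demands are met strictly, which leaves room for a higher
level in the next block. -/
theorem exists_next_level {l : ℕ → ℝ} (hl : Antitone l) {ω : ℕ → ℝ} {a r : ℕ}
    {W : ℝ} {c₀ : ℝ}
    (hc₀ : ∀ j, a < j → j ≤ r → ω j - W < ∑ i ∈ Ico a j, max (l i - c₀) 0)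
    (hω : ∃ j, a < j ∧ j ≤ r ∧ 0 < ω j - W) :
    ∃ c b, c₀ < c ∧ a < b ∧ b ≤ r ∧
      (∀ j, a < j → j ≤ r → ω j - W ≤ ∑ i ∈ Ico a j, max (l i - c) 0) ∧
      ω b - W = ∑ i ∈ Ico a b, max (l i - c) 0 ∧
      ∀ j, b < j → j ≤ r → ω j - W < ∑ i ∈ Ico a j, max (l i - c) 0 := by
  have hcont : ∀ j, Continuous fun c : ℝ => ∑ i ∈ Ico a j, max (l i - c) 0 := fun j => by
    fun_prop
  set C : Set ℝ := {c | ∀ j, a < j → j ≤ r → ω j - W ≤ ∑ i ∈ Ico a j, max (l i - c) 0} with hC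
  have hclosed : IsClosed C := by
    simp only [hC, Set.ofPred_forall]
    exact isClosed_iInter fun j => isClosed_iInter fun _ => isClosed_iInter fun _ =>
      isClosed_le continuous_const (hcont j)
  -- Finitely many strict inequalities, continuous in the level, survive a small increase of it.
  have hpush : ∀ c, (∀ j, a < j → j ≤ r → ω j - W < ∑ i ∈ Ico a j, max (l i - c) 0) →
      ∃ c' ∈ C, c < c' := by
    intro c h
    have h1 : ∀ᶠ c' in nhdsWithin c (Set.Ioi c), ∀ j ∈ Finset.Ioc a r,
        ω j - W < ∑ i ∈ Ico a j, max (l i - c') 0 := by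
      rw [Filter.eventually_all_finset]
      intro j hj
      rw [Finset.mem_Ioc] at hj
      exact ((hcont j).continuousAt.eventually (lt_mem_nhds (h j hj.1 hj.2))).filter_mono
        nhdsWithin_le_nhds
    obtain ⟨c', h2, h3⟩ := (h1.and self_mem_nhdsWithin).exists
    exact ⟨c', fun j hj hj' => (h2 j (Finset.mem_Ioc.mpr ⟨hj, hj'⟩)).le, h3⟩
  have hbdd : BddAbove C := by
    obtain ⟨j, hj, hj', hpos⟩ := hω
    refine ⟨l a, fun c hcC => ?_⟩
    by_contra hlt
    have h0 : ∑ i ∈ Ico a j, max (l i - c) 0 = 0 := by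
      refine sum_eq_zero fun i hi => max_eq_right ?_
      have := hl (mem_Ico.mp hi).1
      linarith
    have := hcC j hj hj'
    linarith
  have hne : C.Nonempty := ⟨c₀, fun j hj hj' => (hc₀ j hj hj').le⟩
  have hmem : sSup C ∈ C := hclosed.csSup_mem hne hbdd
  have hgt : c₀ < sSup C := by
    obtain ⟨c', h1, h2⟩ := hpush c₀ hc₀
    exact h2.trans_le (le_csSup hbdd h1)
  set B := (Finset.Ioc a r).filter
    fun j => ω j - W = ∑ i ∈ Ico a j, max (l i - sSup C) 0 with hB
  have hBne : B.Nonempty := by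
    by_contra hemp
    rw [Finset.not_nonempty_iff_eq_empty] at hemp
    obtain ⟨c', h1, h2⟩ := hpush (sSup C) fun j hj hj' =>
      lt_of_le_of_ne (hmem j hj hj') fun heq => by
        have : j ∈ B := by simp [hB, hj, hj', heq]
        simp [hemp] at this
    exact absurd (le_csSup hbdd h1) (not_le.mpr h2)
  have hmax := B.max'_mem hBne
  have hmax' := hmax
  simp only [hB, Finset.mem_filter, Finset.mem_Ioc] at hmax'
  refine ⟨sSup C, B.max' hBne, hgt, hmax'.1.1, hmax'.1.2, hmem, hmax'.2, fun j hj hj' => ?_⟩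
  refine lt_of_le_of_ne (hmem j (hmax'.1.1.trans hj) hj') fun heq => ?_
  have : j ∈ B := by
    simp only [hB, Finset.mem_filter, Finset.mem_Ioc]
    exact ⟨⟨hmax'.1.1.trans hj, hj'⟩, heq⟩
  exact absurd (B.le_max' j this) (not_le.mpr hj)

theorem sum_range_le_ite {w : ℕ → ℝ} (hw : ∀ i, 0 ≤ w i) {N r j : ℕ} (hrN : r ≤ N) :
    ∑ i ∈ range j, w i ≤ ∑ i ∈ range (if j = r then N else j), w i := by
  split_ifs with h
  · exact sum_le_sum_of_subset_of_nonneg (range_mono (by omega)) fun i _ _ => hw i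
  · exact le_rfl

/-- Induction on the number `s` of indices left. The invariant is that level `c₀` meets all
remaining demands strictly; it forces the next level above `c₀`, and the choice of the last tight
index restores it. -/
theorem exists_waterFilling_from {l w : ℕ → ℝ} (hl : Antitone l) (hw : ∀ i, 0 ≤ w i) {N r : ℕ}
    (hrN : r ≤ N) (s : ℕ) : ∀ (a : ℕ) (c₀ : ℝ), a + s = r →
    (∀ j, a < j → j ≤ r → ∑ i ∈ range (if j = r then N else j), w i - ∑ i ∈ range a, w i <
      ∑ i ∈ Ico a j, max (l i - c₀) 0) →
    ∃ (p : ℕ) (e : Fin (p + 1) → ℕ) (c : Fin p → ℝ), e 0 = a ∧ StrictMono e ∧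
      e (Fin.last p) = r ∧ StrictMono c ∧ (∀ k, c₀ < c k) ∧ IsWaterFilling l w N e c := by
  induction s using Nat.strong_induction_on with
  | _ s ih =>
    intro a c₀ has hc₀
    rcases Nat.eq_zero_or_pos s with rfl | hs
    · refine ⟨0, fun _ => a, Fin.elim0, rfl, ?_, by simpa using has, fun k => k.elim0,
        fun k => k.elim0, fun k => k.elim0⟩
      intro i j hij
      have := Fin.lt_def.mp hij
      omega
    have har : a < r := by omega
    set ω : ℕ → ℝ := fun j => ∑ i ∈ range (if j = r then N else j), w i with hωdef
    have hωle : ∀ j, ∑ i ∈ range j, w i ≤ ω j := fun j => sum_range_le_ite hw hrN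
    have key : ∃ c b, c₀ < c ∧ a < b ∧ b ≤ r ∧
        (∀ j, a < j → j ≤ b → ω j - ∑ i ∈ range a, w i ≤ ∑ i ∈ Ico a j, max (l i - c) 0) ∧
        ω b - ∑ i ∈ range a, w i = ∑ i ∈ Ico a b, max (l i - c) 0 ∧
        ∀ j, b < j → j ≤ r → ω j - ∑ i ∈ range a, w i < ∑ i ∈ Ico a j, max (l i - c) 0 := by
      by_cases hω : ∃ j, a < j ∧ j ≤ r ∧ 0 < ω j - ∑ i ∈ range a, w i
      · obtain ⟨c, b, h1, h2, h3, h4, h5, h6⟩ :=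
          exists_next_level hl (ω := ω) (W := ∑ i ∈ range a, w i) hc₀ hω
        exact ⟨c, b, h1, h2, h3, fun j hj hj' => h4 j hj (hj'.trans h3), h5, h6⟩
      · push Not at hω
        -- No demand is left: a level above `c₀` and all remaining `l i` closes the construction
        -- with one block of zero content.
        refine ⟨max (c₀ + 1) (l a), r, (lt_add_one c₀).trans_le (le_max_left _ _), har, le_rfl,
          fun j hj hj' => (hω j hj hj').trans (sum_nonneg fun i _ => le_max_right _ _), ?_,
          fun j hj hj' => absurd hj (not_lt.mpr hj')⟩
        have h0 : ∑ i ∈ Ico a r, max (l i - max (c₀ + 1) (l a)) 0 = 0 := by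
          refine sum_eq_zero fun i hi => max_eq_right ?_
          have := hl (mem_Ico.mp hi).1
          have := le_max_right (c₀ + 1) (l a)
          linarith
        rw [h0]
        refine le_antisymm (hω r har le_rfl) (sub_nonneg.mpr ?_)
        exact (sum_le_sum_of_subset_of_nonneg (range_mono har.le) fun i _ _ => hw i).trans
          (hωle r)
    obtain ⟨c, b, hc, hab, hbr, hle, heq, hlt⟩ := key
    obtain ⟨p, e', c', he0, he, hel, hcm, hcc, hwf⟩ := ih (r - b) (by omega) b c (by omega) (by
      intro j hj hj'
      have h1 := hlt j hj hj'
      have h2 : ω b = ∑ i ∈ range b, w i := by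
        simp only [hωdef]
        rw [if_neg (by omega)]
      rw [← sum_Ico_consecutive _ hab.le hj.le] at h1
      change ω j - _ < _
      linarith)
    have hlast : ∀ k : Fin (p + 1), e' k = r ↔ k = Fin.last p := fun k => by
      rw [← hel]
      exact he.injective.eq_iff
    refine ⟨p + 1, Fin.cons a e', Fin.cons c c', rfl, ?_, ?_, ?_, ?_, ?_⟩
    · rw [Fin.strictMono_iff_lt_succ]
      intro i
      refine Fin.cases ?_ (fun i => ?_) i
      · simpa [he0] using hab
      · rw [← Fin.succ_castSucc, Fin.cons_succ, Fin.cons_succ]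
        exact he (Fin.castSucc_lt_succ (i := i))
    · rw [← Fin.succ_last, Fin.cons_succ, hel]
    · intro i j
      refine Fin.cases ?_ (fun i => ?_) i
      · refine Fin.cases ?_ (fun j => ?_) j
        · intro h
          exact absurd h (lt_irrefl _)
        · intro _
          simpa using hcc j
      · refine Fin.cases ?_ (fun j => ?_) j
        · intro h
          exact absurd h (by simp)
        · intro h
          simpa using hcm (Fin.succ_lt_succ_iff.mp h)
    · intro k
      refine Fin.cases ?_ (fun k => ?_) k
      · simpa using hc
      · simpa using hc.trans (hcc k)
    · intro k
      refine Fin.cases ?_ (fun k => ?_) k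
      · simp only [Fin.castSucc_zero, Fin.cons_zero, Fin.cons_succ, he0]
        constructor
        · intro j hj hj'
          rcases hj.eq_or_lt with rfl | hj
          · simp
          · have h1 := hle j hj hj'
            have h2 := hωle j
            rw [sum_Ico_eq_sub _ hj.le]
            linarith
        · have h1 : (if Fin.succ (0 : Fin (p + 1)) = Fin.last (p + 1) then N else b) =
              if b = r then N else b := by
            simp only [← Fin.succ_last, Fin.succ_inj, ← he0, hlast]
          rw [h1, sum_Ico_eq_sub _ (by split_ifs <;> omega), ← heq]
      · have := hwf k
        simpa only [← Fin.succ_castSucc, Fin.cons_succ, ← Fin.succ_last, Fin.succ_inj] using this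

theorem exists_waterFilling {l w : ℕ → ℝ} (hl : Antitone l) (hl0 : ∀ i, 0 ≤ l i)
    (hw : ∀ i, 0 ≤ w i) {N r : ℕ} (hrN : r ≤ N) :
    ∃ (p : ℕ) (e : Fin (p + 1) → ℕ) (c : Fin p → ℝ), e 0 = 0 ∧ StrictMono e ∧
      e (Fin.last p) = r ∧ StrictMono c ∧ IsWaterFilling l w N e c := by
  -- The initial level is so low that the first entry alone exceeds the total weight.
  obtain ⟨p, e, c, h1, h2, h3, h4, -, h5⟩ := exists_waterFilling_from hl hw hrN r 0
    (-(∑ i ∈ range N, w i + 1)) (by omega) (by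
      intro j hj hj'
      have h0 : ∑ i ∈ range (if j = r then N else j), w i ≤ ∑ i ∈ range N, w i :=
        sum_le_sum_of_subset_of_nonneg (range_mono (by split_ifs <;> omega)) fun i _ _ => hw i
      have h1 : max (l 0 - -(∑ i ∈ range N, w i + 1)) 0 ≤
          ∑ i ∈ Ico 0 j, max (l i - -(∑ i ∈ range N, w i + 1)) 0 :=
        single_le_sum (f := fun i => max (l i - -(∑ i ∈ range N, w i + 1)) 0)
          (fun i _ => le_max_right _ _) (by simpa using hj)
      have h2 := le_max_left (l 0 - -(∑ i ∈ range N, w i + 1)) 0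
      have h3 := hl0 0
      rw [range_zero, sum_empty]
      linarith)
  exact ⟨p, e, c, h1, h2, h3, h4, h5⟩

/-! ### Majorization on blocks of non-increasing vectors -/

theorem map_valEmbedding_block {N a b : ℕ} (hb : b ≤ N) :
    (block N a b).map Fin.valEmbedding = Ico a b := by
  ext i
  simp only [block, mem_map, mem_filter, mem_univ, true_and, Fin.valEmbedding_apply, mem_Ico]
  constructor
  · rintro ⟨k, hk, rfl⟩
    exact hk
  · intro hi
    exact ⟨⟨i, by omega⟩, hi, rfl⟩

theorem card_block {N a b : ℕ} (hb : b ≤ N) : (block N a b).card = b - a := by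
  rw [← Finset.card_map Fin.valEmbedding, map_valEmbedding_block hb, Nat.card_Ico]

theorem map_block_val {N a b : ℕ} (hb : b ≤ N) {x : Fin N → ℝ} {F : ℕ → ℝ}
    (hF : ∀ i : Fin N, x i = F i) :
    (block N a b).val.map x = (((List.range' a (b - a)).map F : List ℝ) : Multiset ℝ) := by
  have h1 : x = F ∘ Fin.valEmbedding := funext hF
  have h2 : (Ico a b).val = ((List.range' a (b - a) : List ℕ) : Multiset ℕ) := rfl
  rw [h1, ← Multiset.map_map, ← Finset.map_val, map_valEmbedding_block hb, h2, Multiset.map_coe]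

theorem sum_block_eq {N a b : ℕ} (hb : b ≤ N) {x : Fin N → ℝ} {F : ℕ → ℝ}
    (hF : ∀ i : Fin N, x i = F i) : ∑ i ∈ block N a b, x i = ∑ i ∈ Ico a b, F i := by
  rw [← map_valEmbedding_block hb, Finset.sum_map]
  exact Finset.sum_congr rfl fun i _ => hF i

theorem topSum_block {N a b j : ℕ} (hb : b ≤ N) (hj : a + j ≤ b) {x : Fin N → ℝ} {F : ℕ → ℝ}
    (hx : Antitone x) (hF : ∀ i : Fin N, x i = F i) :
    topSum (block N a b) x j = ∑ i ∈ Ico a (a + j), F i := by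
  have hpw : ((List.range' a (b - a)).map F).Pairwise (· ≥ ·) := by
    rw [List.pairwise_map]
    refine List.Pairwise.imp_of_mem ?_ (List.pairwise_lt_range' (s := a) (n := b - a))
    intro i k hi hk hik
    rw [List.mem_range'_1] at hi hk
    have := hx (show (⟨i, by omega⟩ : Fin N) ≤ ⟨k, by omega⟩ from hik.le)
    rwa [hF, hF] at this
  have hsort : ((block N a b).val.map x).sort (· ≥ ·) = (List.range' a (b - a)).map F := by
    refine List.Perm.eq_of_pairwise' (Multiset.pairwise_sort _ _) hpw ?_
    rw [← Multiset.coe_eq_coe, Multiset.sort_eq, map_block_val hb hF]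
  have h2 : (Ico a (a + j)).val = ((List.range' a j : List ℕ) : Multiset ℕ) := by
    change ((List.range' a (a + j - a) : List ℕ) : Multiset ℕ) = _
    rw [Nat.add_sub_cancel_left]
  have h3 : (List.range' a (b - a)).take j = List.range' a j := by
    rw [show b - a = j + (b - a - j) by omega, ← List.range'_append_1]
    simp
  rw [topSum, hsort, ← List.map_take, h3, Finset.sum, h2, Multiset.map_coe, Multiset.sum_coe]

theorem majorized_block_iff {N d a b b' : ℕ} (hab : a ≤ b) (hbd : b ≤ d) (hb' : b' ≤ N)
    (hbb' : b ≤ b') {x : Fin N → ℝ} {y : Fin d → ℝ} {F G : ℕ → ℝ} (hx : Antitone x)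
    (hy : Antitone y) (hF : ∀ i : Fin N, x i = F i) (hG : ∀ i : Fin d, y i = G i) :
    Majorized (block N a b') x (block d a b) y ↔
      (∀ j, a ≤ j → j ≤ b → ∑ i ∈ Ico a j, F i ≤ ∑ i ∈ Ico a j, G i) ∧
        ∑ i ∈ Ico a b', F i = ∑ i ∈ Ico a b, G i := by
  rw [Majorized, card_block hb', card_block hbd, Nat.min_eq_right (by omega),
    sum_block_eq hb' hF, sum_block_eq hbd hG]
  refine and_congr_left fun _ => ⟨fun h j hj hj' => ?_, fun h j hj => ?_⟩
  · have := h (j - a) (by omega)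
    rwa [topSum_block hb' (by omega) hx hF, topSum_block hbd (by omega) hy hG,
      Nat.add_sub_cancel' hj] at this
  · rw [topSum_block hb' (by omega) hx hF, topSum_block hbd (by omega) hy hG]
    exact h _ (by omega) (by omega)

theorem majorized_blocks_iff {d N p : ℕ} {l : Fin d → ℝ} {w : Fin N → ℝ} (hl : Antitone l)
    (hw : Antitone w) {e : Fin (p + 1) → ℕ} (he : StrictMono e)
    (hel : e (Fin.last p) = min d N) (c : Fin p → ℝ) :
    (∀ k : Fin p,
      Majorized (block N (e k.castSucc) (if k.succ = Fin.last p then N else e k.succ)) w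
        (block d (e k.castSucc) (e k.succ)) (fun i => max (l i - c k) 0)) ↔
      IsWaterFilling (zeroExt l) (zeroExt w) N e c := by
  refine forall_congr' fun k => ?_
  have h1 : e k.succ ≤ min d N := hel ▸ he.monotone (Fin.le_last _)
  have h2 : e k.castSucc ≤ e k.succ := (he (Fin.castSucc_lt_succ (i := k))).le
  refine majorized_block_iff (F := zeroExt w) (G := fun i => max (zeroExt l i - c k) 0) h2
    (by omega) (by split_ifs <;> omega) (by split_ifs <;> omega) hw
    (fun i j hij => max_le_max (by linarith [hl hij]) le_rfl) (by simp) (by simp)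

/-! ### Admissible spectra and the optimal one -/

/-- The admissible spectra of frame operators of sequences of vectors with squared norms `w`. -/
structure IsAdmissible {d N : ℕ} (w : Fin N → ℝ) (ν : Fin d → ℝ) : Prop where
  nonneg : ∀ i, 0 ≤ ν i
  prefix_le : ∀ j, ∑ i ∈ range j, zeroExt w i ≤ ∑ i ∈ range j, zeroExt ν i
  sum_eq : ∑ i, w i = ∑ i, ν i

theorem sum_range_eq_of_eq_zero {M : Type*} [AddCommMonoid M] {F : ℕ → M} {a b : ℕ} (hab : a ≤ b)
    (h : ∀ i, a ≤ i → i < b → F i = 0) : ∑ i ∈ range b, F i = ∑ i ∈ range a, F i := by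
  rw [← sum_range_add_sum_Ico _ hab, sum_eq_zero (s := Ico a b), add_zero]
  intro i hi
  rw [mem_Ico] at hi
  exact h i hi.1 hi.2

/-- The first `N` entries of `ν` already exhaust the total, and the others are non-negative. -/
theorem IsAdmissible.eq_zero {d N : ℕ} {w : Fin N → ℝ} {ν : Fin d → ℝ} (h : IsAdmissible w ν)
    {i : ℕ} (hi : N ≤ i) : zeroExt ν i = 0 := by
  by_cases hid : i < d
  · have h1 := h.prefix_le N
    have h2 := h.sum_eq
    rw [sum_univ_eq_sum_range_zeroExt, sum_univ_eq_sum_range_zeroExt] at h2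
    rw [h2, ← sum_range_add_sum_Ico _ (hi.trans hid.le)] at h1
    have h3 := single_le_sum (f := zeroExt ν) (s := Ico N d)
      (fun i _ => zeroExt_nonneg h.nonneg i) (mem_Ico.mpr ⟨hi, hid⟩)
    exact le_antisymm (by linarith) (zeroExt_nonneg h.nonneg i)
  · exact zeroExt_of_le _ (not_lt.mp hid)

theorem IsAdmissible.sum_min {d N : ℕ} {w : Fin N → ℝ} {ν : Fin d → ℝ} (h : IsAdmissible w ν) :
    ∑ i ∈ range (min d N), zeroExt ν i = ∑ i ∈ range N, zeroExt w i := by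
  rw [← sum_univ_eq_sum_range_zeroExt w, h.sum_eq, sum_univ_eq_sum_range_zeroExt]
  refine (sum_range_eq_of_eq_zero (min_le_left _ _) fun i hi hi' => h.eq_zero ?_).symm
  omega

theorem exists_block_index {p : ℕ} {e : Fin (p + 1) → ℕ} (k : Fin (p + 1)) {i : ℕ}
    (h0 : e 0 ≤ i) (hk : i < e k) : ∃ k' : Fin p, e k'.castSucc ≤ i ∧ i < e k'.succ := by
  induction k using Fin.induction with
  | zero => omega
  | succ k ih =>
    by_cases h : i < e k.castSucc
    · exact ih h
    · exact ⟨k, not_lt.mp h, hk⟩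

/-- The variational inequality that characterizes `l - δ` as the nearest point to `l` in the convex
set of admissible vectors. -/
theorem IsSpectralDiff.optimal {d N : ℕ} (hd : 0 < d) {l : Fin d → ℝ} {w : Fin N → ℝ}
    (hl : Antitone l) (hw : Antitone w) (hw0 : ∀ i, 0 ≤ w i) {δ : Fin d → ℝ}
    (h : IsSpectralDiff l w δ) :
    IsAdmissible w (fun i => l i - δ i) ∧
      ∀ ν : Fin d → ℝ, IsAdmissible w ν → ∑ i, δ i * (ν i - (l i - δ i)) ≤ 0 := by
  obtain ⟨p, e, c, he0, he, hel, hc, hmaj, hδ, hδ'⟩ := h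
  rw [majorized_blocks_iff hl hw he hel] at hmaj
  have heN : e (Fin.last p) ≤ N := hel ▸ min_le_right _ _
  have hN : p = 0 → N = 0 := by
    rintro rfl
    have h1 : min d N = 0 := by
      exact hel.symm.trans he0
    omega
  have hle : ∀ k, e k ≤ min d N := fun k => hel ▸ he.monotone (Fin.le_last k)
  have hδe : ∀ k : Fin p, ∀ i, e k.castSucc ≤ i → i < e k.succ →
      zeroExt δ i = min (c k) (zeroExt l i) := by
    intro k i h1 h2
    have h3 := hle k.succ
    rw [zeroExt_of_lt δ (by omega), zeroExt_of_lt l (by omega)]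
    exact hδ k _ (by simp [block, h1, h2])
  have hsub : zeroExt (fun i => l i - δ i) = fun i => zeroExt l i - zeroExt δ i := by
    funext i
    unfold zeroExt
    split_ifs <;> simp
  have hz : ∀ i, min d N ≤ i → zeroExt l i - zeroExt δ i = 0 := by
    intro i hi
    by_cases hid : i < d
    · rw [zeroExt_of_lt _ hid, zeroExt_of_lt _ hid, hδ' _ hi, sub_self]
    · rw [zeroExt_of_le _ (not_lt.mp hid), zeroExt_of_le _ (not_lt.mp hid), sub_self]
  have htot := hmaj.prefix_eq he0 he heN hN hδe (Fin.last p)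
  rw [if_pos rfl, hel] at htot
  have hadm : IsAdmissible w (fun i => l i - δ i) := by
    refine ⟨fun i => ?_, fun j => ?_, ?_⟩
    · by_cases hi : (i : ℕ) < min d N
      · obtain ⟨k, h1, h2⟩ := exists_block_index (e := e) (Fin.last p) (i := i) (by omega) (by omega)
        rw [hδ k i (by simp [block, h1, h2])]
        exact sub_nonneg.mpr (min_le_right _ _)
      · rw [hδ' i (not_lt.mp hi), sub_self]
    · rw [hsub]
      rcases le_total j (min d N) with hj | hj
      · exact hmaj.prefix_le he0 he heN hN hδe (Fin.last p) j (hel ▸ hj)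
      · rw [sum_range_eq_of_eq_zero hj fun i hi _ => hz i hi, htot]
        rcases le_total j N with hjN | hjN
        · exact sum_le_sum_of_subset_of_nonneg (range_mono hjN) fun i _ _ => zeroExt_nonneg hw0 i
        · rw [sum_range_eq_of_eq_zero hjN fun i hi _ => zeroExt_of_le w hi]
    · rw [sum_univ_eq_sum_range_zeroExt, sum_univ_eq_sum_range_zeroExt, hsub, ← htot]
      exact (sum_range_eq_of_eq_zero (min_le_left _ _) fun i hi _ => hz i hi).symm
  refine ⟨hadm, fun ν hν => ?_⟩
  have hνr := hν.sum_min
  rw [← hel] at hνr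
  -- Any upper bound of the levels serves as `C`, since it multiplies a total excess equal to zero.
  have key := hmaj.sum_mul_le he0 he heN hN hc hδe (zeroExt_nonneg hν.nonneg) hν.prefix_le hνr
    (Fin.last p) (∑ k, |c k|) fun k _ =>
      (le_abs_self _).trans (single_le_sum (f := fun k => |c k|) (fun k _ => abs_nonneg _)
        (mem_univ k))
  rw [hνr, hel, htot, sub_self, mul_zero] at key
  have hext : zeroExt (fun i => δ i * (ν i - (l i - δ i))) =
      fun i => zeroExt δ i * (zeroExt ν i - (zeroExt l i - zeroExt δ i)) := by
    funext i
    unfold zeroExt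
    split_ifs <;> simp
  rw [sum_univ_eq_sum_range_zeroExt, hext, sum_range_eq_of_eq_zero (min_le_left d N)]
  · exact key
  · intro i hi hid
    rw [hz i hi, hν.eq_zero (by omega), sub_zero, mul_zero]

theorem exists_isSpectralDiff {d N : ℕ} {l : Fin d → ℝ} {w : Fin N → ℝ}
    (hl : Antitone l) (hl0 : ∀ i, 0 ≤ l i) (hw : Antitone w) (hw0 : ∀ i, 0 ≤ w i) :
    ∃ δ : Fin d → ℝ, IsSpectralDiff l w δ := by
  obtain ⟨p, e, c, he0, he, hel, hc, hwf⟩ := exists_waterFilling (zeroExt_antitone hl0 hl)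
    (zeroExt_nonneg hl0) (zeroExt_nonneg hw0) (min_le_right d N)
  have hex : ∀ i : Fin d, (i : ℕ) < min d N → ∃ k : Fin p, e k.castSucc ≤ i ∧ (i : ℕ) < e k.succ :=
    fun i hi => exists_block_index (Fin.last p) (by omega) (by omega)
  classical
  refine ⟨fun i => if h : (i : ℕ) < min d N then min (c (hex i h).choose) (l i) else l i,
    p, e, c, he0, he, hel, hc, (majorized_blocks_iff hl hw he hel c).mpr hwf, ?_, ?_⟩
  · intro k i hi
    simp only [block, mem_filter, mem_univ, true_and] at hi
    have h1 : e k.succ ≤ min d N := hel ▸ he.monotone (Fin.le_last _)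
    have h2 : (i : ℕ) < min d N := by omega
    have h3 := (hex i h2).choose_spec
    have h4 : (hex i h2).choose = k := by
      have h5 := he.lt_iff_lt.mp (h3.1.trans_lt hi.2)
      have h6 := he.lt_iff_lt.mp (hi.1.trans_lt h3.2)
      rw [Fin.lt_def] at h5 h6
      simp only [Fin.val_castSucc, Fin.val_succ] at h5 h6
      exact Fin.ext (by omega)
    simp only [dif_pos h2, h4]
  · intro i hi
    simp only [dif_neg (not_lt.mpr hi)]

/-- Admissible spectra satisfy a Pythagorean inequality around the optimal one. -/
theorem IsSpectralDiff.pythagoras {d N : ℕ} (hd : 0 < d) {l : Fin d → ℝ} {w : Fin N → ℝ}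
    (hl : Antitone l) (hw : Antitone w) (hw0 : ∀ i, 0 ≤ w i) {δ : Fin d → ℝ}
    (h : IsSpectralDiff l w δ) {ν : Fin d → ℝ} (hν : IsAdmissible w ν) :
    ∑ i, δ i ^ 2 + ∑ i, (ν i - (l i - δ i)) ^ 2 ≤ ∑ i, (l i - ν i) ^ 2 := by
  have h1 := (h.optimal hd hl hw hw0).2 ν hν
  have h2 : ∑ i, (l i - ν i) ^ 2 = ∑ i, δ i ^ 2 + ∑ i, (ν i - (l i - δ i)) ^ 2 -
      2 * ∑ i, δ i * (ν i - (l i - δ i)) := by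
    rw [mul_sum, ← sum_add_distrib, ← sum_sub_distrib]
    exact sum_congr rfl fun i _ => by ring
  linarith

theorem eq_of_sum_sq_le_zero {d : ℕ} {x y : Fin d → ℝ} (h : ∑ i, (x i - y i) ^ 2 ≤ 0) :
    x = y := by
  have h1 := (sum_eq_zero_iff_of_nonneg fun i _ => sq_nonneg (x i - y i)).mp
    (le_antisymm h (sum_nonneg fun i _ => sq_nonneg _))
  funext i
  exact sub_eq_zero.mp (pow_eq_zero_iff two_ne_zero |>.mp (h1 i (mem_univ i)))

/-- A projection is unique: add the Pythagorean inequalities of each solution at the other. -/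
theorem IsSpectralDiff.unique {d N : ℕ} (hd : 0 < d) {l : Fin d → ℝ} {w : Fin N → ℝ}
    (hl : Antitone l) (hw : Antitone w) (hw0 : ∀ i, 0 ≤ w i) {δ δ' : Fin d → ℝ}
    (h : IsSpectralDiff l w δ) (h' : IsSpectralDiff l w δ') : δ' = δ := by
  have h1 := h.pythagoras hd hl hw hw0 (h'.optimal hd hl hw hw0).1
  have h2 := h'.pythagoras hd hl hw hw0 (h.optimal hd hl hw hw0).1
  simp only [sub_sub_cancel] at h1 h2
  have h3 : ∑ i, (l i - δ' i - (l i - δ i)) ^ 2 ≤ 0 := by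
    have : 0 ≤ ∑ i, (l i - δ i - (l i - δ' i)) ^ 2 := sum_nonneg fun i _ => sq_nonneg _
    linarith
  have h4 := eq_of_sum_sq_le_zero h3
  funext i
  have := congrFun h4 i
  linarith

/-! ### The real Frobenius inner product -/

/-- The real Frobenius inner product of two complex matrices. -/
noncomputable def frob {m d : ℕ} (M M' : Matrix (Fin m) (Fin d) ℂ) : ℝ :=
  ∑ a, ∑ b, (star (M a b) * M' a b).re

section Frobenius

variable {m d : ℕ} (M M' M'' : Matrix (Fin m) (Fin d) ℂ)

theorem norm_sq_eq_sum : ‖M‖ ^ 2 = ∑ a, ∑ b, ‖M a b‖ ^ 2 := by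
  rw [Matrix.frobenius_norm_def, ← Real.sqrt_eq_rpow, Real.sq_sqrt (by positivity)]
  simp

theorem frob_self : frob M M = ‖M‖ ^ 2 := by
  rw [norm_sq_eq_sum]
  refine sum_congr rfl fun a _ => sum_congr rfl fun b _ => ?_
  rw [Complex.star_def, ← Complex.normSq_eq_conj_mul_self, Complex.ofReal_re,
    Complex.normSq_eq_norm_sq]

theorem frob_comm : frob M M' = frob M' M := by
  refine sum_congr rfl fun a _ => sum_congr rfl fun b _ => ?_
  simp only [Complex.star_def, Complex.mul_re, Complex.conj_re, Complex.conj_im]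
  ring

theorem frob_add_right : frob M (M' + M'') = frob M M' + frob M M'' := by
  simp only [frob, Matrix.add_apply, mul_add, Complex.add_re, sum_add_distrib]

theorem frob_add_left : frob (M + M') M'' = frob M M'' + frob M' M'' := by
  rw [frob_comm, frob_add_right, frob_comm M'', frob_comm M'']

theorem frob_smul_right (c : ℝ) : frob M ((c : ℂ) • M') = c * frob M M' := by
  simp only [frob, Matrix.smul_apply, smul_eq_mul, mul_sum]
  refine sum_congr rfl fun a _ => sum_congr rfl fun b _ => ?_
  rw [mul_left_comm, Complex.re_ofReal_mul]

theorem frob_sub_right : frob M (M' - M'') = frob M M' - frob M M'' := by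
  have h := frob_add_right M (M' - M'') M''
  rw [sub_add_cancel] at h
  linarith

theorem frob_sum_right {ι : Type*} (s : Finset ι) (F : ι → Matrix (Fin m) (Fin d) ℂ) :
    frob M (∑ i ∈ s, F i) = ∑ i ∈ s, frob M (F i) := by
  classical
  induction s using Finset.induction_on with
  | empty => simp [frob]
  | insert i s hi ih => rw [sum_insert hi, sum_insert hi, frob_add_right, ih]

theorem norm_add_sq_eq : ‖M + M'‖ ^ 2 = ‖M‖ ^ 2 + 2 * frob M M' + ‖M'‖ ^ 2 := by
  simp only [← frob_self, frob_add_left, frob_add_right, frob_comm M' M]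
  ring

theorem norm_sub_sq_eq : ‖M - M'‖ ^ 2 = ‖M‖ ^ 2 - 2 * frob M M' + ‖M'‖ ^ 2 := by
  have h := norm_add_sq_eq (M - M') M'
  rw [sub_add_cancel, frob_comm, frob_sub_right, frob_self, frob_comm] at h
  linarith

end Frobenius

/-! ### Spectral sums -/

theorem frob_rankOne {d : ℕ} (x y : EuclideanSpace ℂ (Fin d)) :
    frob (rankOne x x) (rankOne y y) = ‖inner ℂ x y‖ ^ 2 := by
  rw [← Complex.normSq_eq_norm_sq, ← Complex.ofReal_re (Complex.normSq _),
    ← Complex.mul_conj, PiLp.inner_apply, map_sum, sum_mul_sum, Complex.re_sum]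
  refine sum_congr rfl fun a _ => ?_
  rw [Complex.re_sum]
  refine sum_congr rfl fun b _ => ?_
  congr 1
  simp [rankOne]
  ring

theorem frob_one_rankOne {d : ℕ} (x : EuclideanSpace ℂ (Fin d)) :
    frob 1 (rankOne x x) = ‖x‖ ^ 2 := by
  rw [EuclideanSpace.norm_sq_eq]
  refine sum_congr rfl fun a _ => ?_
  rw [sum_eq_single a]
  · rw [Matrix.one_apply_eq, star_one, one_mul, rankOne, Matrix.of_apply, Complex.star_def,
      Complex.mul_conj, Complex.ofReal_re, Complex.normSq_eq_norm_sq]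
  · intro b _ hb
    rw [Matrix.one_apply_ne hb.symm]
    simp
  · simp

/-- The matrix with eigenvalues `c` and eigenvectors `v`. -/
noncomputable def spectralSum {d : ℕ} (v : Fin d → EuclideanSpace ℂ (Fin d)) (c : Fin d → ℝ) :
    Matrix (Fin d) (Fin d) ℂ :=
  ∑ i, (c i : ℂ) • rankOne (v i) (v i)

section SpectralSum

variable {d : ℕ} (v : Fin d → EuclideanSpace ℂ (Fin d))

theorem frob_spectralSum (M : Matrix (Fin d) (Fin d) ℂ) (c : Fin d → ℝ) :
    frob M (spectralSum v c) = ∑ i, c i * frob M (rankOne (v i) (v i)) := by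
  rw [spectralSum, frob_sum_right]
  exact sum_congr rfl fun i _ => frob_smul_right _ _ _

theorem frob_spectralSum_rankOne (c : Fin d → ℝ) (x : EuclideanSpace ℂ (Fin d)) :
    frob (spectralSum v c) (rankOne x x) = ∑ i, c i * ‖inner ℂ (v i) x‖ ^ 2 := by
  rw [frob_comm, frob_spectralSum]
  exact sum_congr rfl fun i _ => by rw [frob_rankOne, norm_inner_symm]

theorem spectralSum_sub (c c' : Fin d → ℝ) :
    spectralSum v c - spectralSum v c' = spectralSum v fun i => c i - c' i := by
  simp [spectralSum, sub_smul]

variable {v}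

theorem frob_spectralSum_rankOne_self (hv : Orthonormal ℂ v) (c : Fin d → ℝ) (i : Fin d) :
    frob (spectralSum v c) (rankOne (v i) (v i)) = c i := by
  rw [frob_spectralSum_rankOne, sum_eq_single i]
  · simp [hv.1 i]
  · intro j _ hj
    simp [hv.2 hj]
  · simp

theorem norm_spectralSum_sq (hv : Orthonormal ℂ v) (c : Fin d → ℝ) :
    ‖spectralSum v c‖ ^ 2 = ∑ i, c i ^ 2 := by
  rw [← frob_self, frob_spectralSum]
  exact sum_congr rfl fun i _ => by rw [frob_spectralSum_rankOne_self hv, sq]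

theorem frob_one_spectralSum (hv : Orthonormal ℂ v) (c : Fin d → ℝ) :
    frob 1 (spectralSum v c) = ∑ i, c i := by
  rw [frob_spectralSum]
  exact sum_congr rfl fun i _ => by rw [frob_one_rankOne, hv.1 i, one_pow, mul_one]

/-- A matrix whose diagonal in an orthonormal basis carries its whole Frobenius norm is
diagonal in that basis. -/
theorem eq_spectralSum_of_norm_sq (hv : Orthonormal ℂ v) {M : Matrix (Fin d) (Fin d) ℂ}
    {c : Fin d → ℝ} (hc : ∀ i, frob M (rankOne (v i) (v i)) = c i)
    (hM : ‖M‖ ^ 2 = ∑ i, c i ^ 2) : M = spectralSum v c := by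
  have h1 : frob M (spectralSum v c) = ∑ i, c i ^ 2 := by
    rw [frob_spectralSum]
    exact sum_congr rfl fun i _ => by rw [hc, sq]
  have h2 : ‖M - spectralSum v c‖ ^ 2 = 0 := by
    rw [norm_sub_sq_eq, h1, norm_spectralSum_sq hv, hM]
    ring
  exact sub_eq_zero.mp (norm_eq_zero.mp (pow_eq_zero_iff two_ne_zero |>.mp h2))

end SpectralSum

theorem spec_antitone {d : ℕ} {A : Matrix (Fin d) (Fin d) ℂ} (hA : A.PosSemidef) :
    Antitone (spec hA) :=
  fun _ _ hij => hA.isHermitian.eigenvalues₀_antitone hij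

theorem exists_spec_eq_eigenvalues {d : ℕ} {A : Matrix (Fin d) (Fin d) ℂ} (hA : A.PosSemidef) :
    ∃ σ : Fin d ≃ Fin d, ∀ i, hA.isHermitian.eigenvalues (σ i) = spec hA i :=
  ⟨(finCongr (Fintype.card_fin d).symm).trans (Fintype.equivOfCardEq (Fintype.card_fin _)),
    fun i => by simp [spec, Matrix.IsHermitian.eigenvalues]⟩

theorem spec_nonneg {d : ℕ} {A : Matrix (Fin d) (Fin d) ℂ} (hA : A.PosSemidef) (i : Fin d) :
    0 ≤ spec hA i := by
  obtain ⟨σ, hσ⟩ := exists_spec_eq_eigenvalues hA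
  rw [← hσ]
  exact hA.eigenvalues_nonneg _

theorem exists_eq_spectralSum {d : ℕ} {A : Matrix (Fin d) (Fin d) ℂ} (hA : A.PosSemidef) :
    ∃ v : OrthonormalBasis (Fin d) ℂ (EuclideanSpace ℂ (Fin d)), A = spectralSum v (spec hA) := by
  obtain ⟨σ, hσ⟩ := exists_spec_eq_eigenvalues hA
  refine ⟨hA.isHermitian.eigenvectorBasis.reindex σ.symm, ?_⟩
  have h1 : spectralSum (hA.isHermitian.eigenvectorBasis.reindex σ.symm) (spec hA) =
      spectralSum hA.isHermitian.eigenvectorBasis hA.isHermitian.eigenvalues := by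
    rw [spectralSum, spectralSum, ← Equiv.sum_comp σ fun i =>
      (hA.isHermitian.eigenvalues i : ℂ) • rankOne (hA.isHermitian.eigenvectorBasis i)
        (hA.isHermitian.eigenvectorBasis i)]
    exact sum_congr rfl fun i _ => by simp [hσ]
  rw [h1]
  conv_lhs => rw [hA.isHermitian.spectral_theorem]
  ext a b
  rw [Unitary.conjStarAlgAut_apply, Matrix.mul_apply]
  simp only [Matrix.mul_diagonal, spectralSum, Matrix.sum_apply, Matrix.smul_apply, rankOne,
    Matrix.of_apply, Matrix.star_apply, Matrix.IsHermitian.eigenvectorUnitary_apply, smul_eq_mul,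
    Function.comp_apply, Complex.coe_algebraMap]
  refine sum_congr rfl fun k _ => ?_
  simp
  ring

/-! ### Ky Fan's inequality -/

/-- With mass at most `j` and capacity one per index, the best choice fills the first `j` indices.
Comparing each `ν i` with the threshold `ν j` proves it. -/
theorem sum_mul_le_sum_range {ν q : ℕ → ℝ} (hν : Antitone ν) (hν0 : ∀ i, 0 ≤ ν i)
    (hq0 : ∀ i, 0 ≤ q i) (hq1 : ∀ i, q i ≤ 1) {d j : ℕ} (hq : ∑ i ∈ range d, q i ≤ j) :
    ∑ i ∈ range d, ν i * q i ≤ ∑ i ∈ range j, ν i := by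
  have h1 : ∀ i, ν i * q i ≤ ν j * q i + if i < j then ν i - ν j else 0 := by
    intro i
    split_ifs with h
    · nlinarith [hν h.le, hq1 i]
    · nlinarith [hν (not_lt.mp h), hq0 i]
  have h2 : ∑ i ∈ range d, (if i < j then ν i - ν j else 0) ≤ ∑ i ∈ range j, (ν i - ν j) := by
    rw [← sum_filter]
    refine sum_le_sum_of_subset_of_nonneg (fun i hi => ?_) fun i hi _ => ?_
    · exact mem_range.mpr (mem_filter.mp hi).2
    · exact sub_nonneg.mpr (hν (mem_range.mp hi).le)
  have h3 := sum_le_sum fun i (_ : i ∈ range d) => h1 i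
  rw [sum_add_distrib, ← mul_sum] at h3
  rw [sum_sub_distrib, sum_const, card_range, nsmul_eq_mul] at h2
  have h4 := mul_le_mul_of_nonneg_left hq (hν0 j)
  linarith

/-- Ky Fan: the eigenvalue `ν i` receives the mass `q i = ∑ ‖⟨u i, b k⟩‖²`, at most one by Bessel,
and Parseval gives total mass `card ι`. -/
theorem sum_frob_rankOne_le {d : ℕ} (u : OrthonormalBasis (Fin d) ℂ (EuclideanSpace ℂ (Fin d)))
    {ν : Fin d → ℝ} (hν : Antitone ν) (hν0 : ∀ i, 0 ≤ ν i) {ι : Type*} [Fintype ι]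
    {b : ι → EuclideanSpace ℂ (Fin d)} (hb : Orthonormal ℂ b) {j : ℕ} (hj : Fintype.card ι ≤ j) :
    ∑ k, frob (spectralSum u ν) (rankOne (b k) (b k)) ≤ ∑ i ∈ range j, zeroExt ν i := by
  set q : Fin d → ℝ := fun i => ∑ k, ‖inner ℂ (u i) (b k)‖ ^ 2 with hq
  have hq0 : ∀ i, 0 ≤ q i := fun i => sum_nonneg fun k _ => by positivity
  have hq1 : ∀ i, q i ≤ 1 := by
    intro i
    have h := hb.sum_inner_products_le (u i) (s := univ)
    simp only [u.norm_eq_one, one_pow] at h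
    refine le_trans (le_of_eq ?_) h
    exact sum_congr rfl fun k _ => by rw [norm_inner_symm]
  have hqs : ∑ i, q i = Fintype.card ι := by
    rw [hq, sum_comm]
    simp [u.sum_sq_norm_inner_right, hb.1]
  have h1 : ∑ k, frob (spectralSum u ν) (rankOne (b k) (b k)) = ∑ i, ν i * q i := by
    simp only [frob_spectralSum_rankOne, hq, mul_sum]
    exact sum_comm
  have h2 : zeroExt (fun i => ν i * q i) = fun i => zeroExt ν i * zeroExt q i := by
    funext i
    unfold zeroExt
    split_ifs <;> simp
  rw [h1, sum_univ_eq_sum_range_zeroExt, h2]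
  refine sum_mul_le_sum_range (zeroExt_antitone hν0 hν) (zeroExt_nonneg hν0)
    (zeroExt_nonneg hq0) (fun i => ?_) ?_
  · unfold zeroExt
    split_ifs
    exacts [hq1 _, zero_le_one]
  · rw [← sum_univ_eq_sum_range_zeroExt, hqs]
    exact_mod_cast hj

/-! ### Frame operators have admissible spectra -/

theorem sum_filter_lt_eq {N : ℕ} (x : Fin N → ℝ) (j : ℕ) :
    ∑ k ∈ univ.filter (fun k : Fin N => (k : ℕ) < j), x k = ∑ i ∈ range j, zeroExt x i := by
  rw [sum_filter, sum_univ_eq_sum_range_zeroExt]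
  have h : zeroExt (fun k : Fin N => if (k : ℕ) < j then x k else 0) =
      fun i => if i < j then zeroExt x i else 0 := by
    funext i
    by_cases h1 : i < N <;> by_cases h2 : i < j <;> simp [zeroExt, h1, h2]
  rw [h, ← sum_filter]
  refine sum_subset (fun i hi => by simpa using (mem_filter.mp hi).2) fun i hi hi' => ?_
  refine zeroExt_of_le _ ?_
  by_contra hlt
  exact hi' (mem_filter.mpr ⟨mem_range.mpr (not_le.mp hlt), mem_range.mp hi⟩)

theorem frob_one_vecFrameOp {N d : ℕ} (f : Fin N → EuclideanSpace ℂ (Fin d)) :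
    frob 1 (vecFrameOp f) = ∑ k, ‖f k‖ ^ 2 := by
  rw [vecFrameOp, frob_sum_right]
  exact sum_congr rfl fun k _ => frob_one_rankOne _

theorem vecFrameOp_posSemidef {N d : ℕ} (f : Fin N → EuclideanSpace ℂ (Fin d)) :
    (vecFrameOp f).PosSemidef := by
  refine Matrix.posSemidef_sum _ fun k _ => ?_
  have h : rankOne (f k) (f k) = Matrix.vecMulVec (fun a => f k a) (star fun a => f k a) := rfl
  rw [h]
  exact Matrix.posSemidef_vecMulVec_self_star _

/-- The span of the first `j` vectors has dimension at most `j`, and compressing the frame operator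
to it keeps at least the norms of these vectors in the trace; Ky Fan bounds that trace. The total is
the full trace. -/
theorem isAdmissible_of_vecFrameOp {N d : ℕ} {w : Fin N → ℝ}
    {f : Fin N → EuclideanSpace ℂ (Fin d)} (hf : f ∈ vecSet d w)
    (u : OrthonormalBasis (Fin d) ℂ (EuclideanSpace ℂ (Fin d))) {ν : Fin d → ℝ}
    (hν : Antitone ν) (hν0 : ∀ i, 0 ≤ ν i) (h : vecFrameOp f = spectralSum u ν) :
    IsAdmissible w ν := by
  refine ⟨hν0, fun j => ?_, ?_⟩
  · set s := univ.filter (fun k : Fin N => (k : ℕ) < j) with hs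
    set V := Submodule.span ℂ (f '' (s : Set (Fin N))) with hV
    have hcard : Module.finrank ℂ V ≤ j := by
      classical
      have h1 : (f '' (s : Set (Fin N))) = ((s.image f : Finset _) : Set _) := by simp
      rw [hV, h1]
      refine (finrank_span_finset_le_card _).trans (card_image_le.trans ?_)
      have h2 : s.map Fin.valEmbedding ⊆ range j := by
        intro i hi
        obtain ⟨k, hk, rfl⟩ := mem_map.mp hi
        exact mem_range.mpr (mem_filter.mp hk).2
      simpa using card_le_card h2
    have hb := (stdOrthonormalBasis ℂ V).orthonormal.comp_linearIsometry V.subtypeₗᵢ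
    refine le_trans ?_ (sum_frob_rankOne_le u hν hν0 hb (by simpa using hcard))
    rw [← h, ← sum_filter_lt_eq]
    have h1 : ∀ x : EuclideanSpace ℂ (Fin d),
        frob (vecFrameOp f) (rankOne x x) = ∑ k, ‖inner ℂ x (f k)‖ ^ 2 := by
      intro x
      rw [frob_comm, vecFrameOp, frob_sum_right]
      exact sum_congr rfl fun k _ => frob_rankOne _ _
    simp only [h1]
    rw [sum_comm]
    refine le_trans ?_ (sum_le_sum_of_subset_of_nonneg (subset_univ s) fun k _ _ =>
      sum_nonneg fun i _ => by positivity)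
    refine sum_le_sum fun k hk => le_of_eq ?_
    have hmem : f k ∈ V := Submodule.subset_span ⟨k, hk, rfl⟩
    have h2 := (stdOrthonormalBasis ℂ V).sum_sq_norm_inner_right ⟨f k, hmem⟩
    rw [← hf k]
    exact h2.symm
  · rw [← frob_one_spectralSum u.orthonormal, ← h, frob_one_vecFrameOp]
    exact sum_congr rfl fun k _ => (hf k).symm

/-! ### Distance between matrices and between spectra -/

theorem sum_mul_le_sum_mul_of_prefix_le {κ x y : ℕ → ℝ} (hκ : Antitone κ) (hκ0 : ∀ i, 0 ≤ κ i)
    (hxy : ∀ j, ∑ i ∈ range j, x i ≤ ∑ i ∈ range j, y i) (d : ℕ) :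
    ∑ i ∈ range d, κ i * x i ≤ ∑ i ∈ range d, κ i * y i := by
  suffices h : ∀ d, κ d * ∑ i ∈ range d, (y i - x i) ≤ ∑ i ∈ range d, κ i * (y i - x i) by
    have h1 := h d
    have h2 : 0 ≤ κ d * ∑ i ∈ range d, (y i - x i) := by
      rw [sum_sub_distrib]
      exact mul_nonneg (hκ0 d) (sub_nonneg.mpr (hxy d))
    simp only [mul_sub, sum_sub_distrib] at h1 h2
    linarith
  intro d
  induction d with
  | zero => simp
  | succ d ih =>
    have h1 := mul_le_mul_of_nonneg_right (hκ d.le_succ)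
      (show 0 ≤ ∑ i ∈ range (d + 1), (y i - x i) by
        rw [sum_sub_distrib]
        exact sub_nonneg.mpr (hxy _))
    rw [sum_range_succ] at h1 ⊢
    rw [sum_range_succ]
    linarith

theorem prefix_diag_le {d : ℕ} (u v : OrthonormalBasis (Fin d) ℂ (EuclideanSpace ℂ (Fin d)))
    {ν : Fin d → ℝ} (hν : Antitone ν) (hν0 : ∀ i, 0 ≤ ν i) (j : ℕ) :
    ∑ i ∈ range j, zeroExt (fun i => frob (spectralSum u ν) (rankOne (v i) (v i))) i ≤
      ∑ i ∈ range j, zeroExt ν i := by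
  rw [← sum_filter_lt_eq]
  set s := univ.filter (fun k : Fin d => (k : ℕ) < j) with hs
  rw [← sum_coe_sort]
  refine sum_frob_rankOne_le u hν hν0
    (v.orthonormal.comp (Subtype.val : s → Fin d) Subtype.val_injective) ?_
  rw [Fintype.card_coe]
  have h2 : s.map Fin.valEmbedding ⊆ range j := by
    intro i hi
    obtain ⟨k, hk, rfl⟩ := mem_map.mp hi
    exact mem_range.mpr (mem_filter.mp hk).2
  simpa using card_le_card h2

theorem zeroExt_eq_of_prefix_eq {x y : ℕ → ℝ}
    (h : ∀ j, ∑ i ∈ range j, x i = ∑ i ∈ range j, y i) : x = y := by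
  funext i
  have h1 := h (i + 1)
  rw [sum_range_succ, sum_range_succ, h i] at h1
  linarith

/-- Ordered spectra are at most as far apart as the matrices, and for equality the matrices have
a common ordered eigenbasis. -/
theorem spectral_distance {d : ℕ} (u u' : OrthonormalBasis (Fin d) ℂ (EuclideanSpace ℂ (Fin d)))
    {l ν : Fin d → ℝ} (hl : Antitone l) (hl0 : ∀ i, 0 ≤ l i) (hν : Antitone ν)
    (hν0 : ∀ i, 0 ≤ ν i) {A S : Matrix (Fin d) (Fin d) ℂ} (hA : A = spectralSum u l)
    (hS : S = spectralSum u' ν) (hpsd : (A + S).PosSemidef) :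
    ∑ i, (l i - ν i) ^ 2 ≤ ‖A - S‖ ^ 2 ∧
      (‖A - S‖ ^ 2 ≤ ∑ i, (l i - ν i) ^ 2 →
        ∃ v : OrthonormalBasis (Fin d) ℂ (EuclideanSpace ℂ (Fin d)),
          A = spectralSum v l ∧ S = spectralSum v ν) := by
  -- Diagonalizing the sum makes its ordered spectrum `κ` equal to `a + s`, the diagonals of `A` and
  -- `S` in the basis `v`. Pairing with `κ` gives `∑ κ² ≤ ∑ κ (l + ν)`, and the parallelogram
  -- identity turns this into the distance bound.
  obtain ⟨v, hv⟩ := exists_eq_spectralSum hpsd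
  set κ := spec hpsd
  set a : Fin d → ℝ := fun i => frob A (rankOne (v i) (v i)) with ha
  set s : Fin d → ℝ := fun i => frob S (rankOne (v i) (v i)) with hs
  have hκ : ∀ i, κ i = a i + s i := fun i => by
    rw [← frob_spectralSum_rankOne_self v.orthonormal κ i, ← hv, frob_add_left]
  have hpa : ∀ j, ∑ i ∈ range j, zeroExt a i ≤ ∑ i ∈ range j, zeroExt l i := fun j => by
    rw [ha, hA]
    exact prefix_diag_le u v hl hl0 j
  have hps : ∀ j, ∑ i ∈ range j, zeroExt s i ≤ ∑ i ∈ range j, zeroExt ν i := fun j => by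
    rw [hs, hS]
    exact prefix_diag_le u' v hν hν0 j
  have hκl : ∑ i, κ i ^ 2 ≤ ∑ i, κ i * (l i + ν i) := by
    have hκe := sum_mul_le_sum_mul_of_prefix_le
      (zeroExt_antitone (spec_nonneg hpsd) (spec_antitone hpsd)) (zeroExt_nonneg (spec_nonneg hpsd))
      (x := fun i => zeroExt a i + zeroExt s i) (y := fun i => zeroExt l i + zeroExt ν i)
      (fun j => by
        rw [sum_add_distrib, sum_add_distrib]
        exact add_le_add (hpa j) (hps j)) d
    rw [← Fin.sum_univ_eq_sum_range (fun i => zeroExt (spec hpsd) i * (zeroExt a i + zeroExt s i)),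
      ← Fin.sum_univ_eq_sum_range
        (fun i => zeroExt (spec hpsd) i * (zeroExt l i + zeroExt ν i))] at hκe
    simp only [zeroExt_val] at hκe
    refine le_trans (le_of_eq (sum_congr rfl fun i _ => ?_)) hκe
    rw [← hκ i, sq]
  have hnA : ‖A‖ ^ 2 = ∑ i, l i ^ 2 := by rw [hA, norm_spectralSum_sq u.orthonormal]
  have hnS : ‖S‖ ^ 2 = ∑ i, ν i ^ 2 := by rw [hS, norm_spectralSum_sq u'.orthonormal]
  have hnP : ‖A + S‖ ^ 2 = ∑ i, κ i ^ 2 := by rw [hv, norm_spectralSum_sq v.orthonormal]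
  have hpar : ‖A - S‖ ^ 2 = 2 * ∑ i, l i ^ 2 + 2 * ∑ i, ν i ^ 2 - ∑ i, κ i ^ 2 := by
    have h1 := norm_add_sq_eq A S
    have h2 := norm_sub_sq_eq A S
    linarith
  have hsq : ∑ i, (κ i - (l i + ν i)) ^ 2 =
      ∑ i, κ i ^ 2 - 2 * ∑ i, κ i * (l i + ν i) + ∑ i, (l i + ν i) ^ 2 := by
    rw [mul_sum, ← sum_sub_distrib, ← sum_add_distrib]
    exact sum_congr rfl fun i _ => by ring
  have hsum : ∑ i, (l i + ν i) ^ 2 + ∑ i, (l i - ν i) ^ 2 =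
      2 * ∑ i, l i ^ 2 + 2 * ∑ i, ν i ^ 2 := by
    rw [mul_sum, mul_sum, ← sum_add_distrib, ← sum_add_distrib]
    exact sum_congr rfl fun i _ => by ring
  have hsq0 : 0 ≤ ∑ i, (κ i - (l i + ν i)) ^ 2 := sum_nonneg fun i _ => sq_nonneg _
  refine ⟨by linarith, fun hle => ⟨v, ?_⟩⟩
  -- Equality makes both families of Ky Fan inequalities tight, so the diagonals of `A` and `S` are
  -- `l` and `ν` and carry their whole norms.
  have hκeq : κ = fun i => l i + ν i := eq_of_sum_sq_le_zero (by linarith)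
  have htot : ∀ j, ∑ i ∈ range j, zeroExt a i + ∑ i ∈ range j, zeroExt s i =
      ∑ i ∈ range j, zeroExt l i + ∑ i ∈ range j, zeroExt ν i := by
    intro j
    rw [← sum_add_distrib, ← sum_add_distrib]
    refine sum_congr rfl fun i _ => ?_
    by_cases hi : i < d
    · simp only [zeroExt_of_lt _ hi]
      rw [← hκ, hκeq]
    · simp only [zeroExt_of_le _ (not_lt.mp hi)]
  have hal : zeroExt a = zeroExt l := zeroExt_eq_of_prefix_eq fun j => by
    linarith [hpa j, hps j, htot j]
  have hsν : zeroExt s = zeroExt ν := zeroExt_eq_of_prefix_eq fun j => by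
    linarith [hpa j, hps j, htot j]
  constructor
  · refine eq_spectralSum_of_norm_sq v.orthonormal (fun i => ?_) hnA
    simpa using congrFun hal i
  · refine eq_spectralSum_of_norm_sq v.orthonormal (fun i => ?_) hnS
    simpa using congrFun hsν i

/-! ### Transfers between coordinates -/

/-- Move the amount `t` from the coordinate `k` to the coordinate `l`. -/
def transfer {N : ℕ} (a : Fin N → ℝ) (k l : Fin N) (t : ℝ) : Fin N → ℝ :=
  fun i => a i - (if i = k then t else 0) + if i = l then t else 0

theorem transfer_apply_left {N : ℕ} (a : Fin N → ℝ) {k l : Fin N} (h : k ≠ l) (t : ℝ) :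
    transfer a k l t k = a k - t := by
  simp [transfer, h]

theorem transfer_apply_right {N : ℕ} (a : Fin N → ℝ) {k l : Fin N} (h : k ≠ l) (t : ℝ) :
    transfer a k l t l = a l + t := by
  simp [transfer, h.symm]

theorem transfer_apply_of_ne {N : ℕ} (a : Fin N → ℝ) {k l i : Fin N} (hk : i ≠ k) (hl : i ≠ l)
    (t : ℝ) : transfer a k l t i = a i := by
  simp [transfer, hk, hl]

theorem sum_transfer {N : ℕ} (a : Fin N → ℝ) (k l : Fin N) (t : ℝ) :
    ∑ i, transfer a k l t i = ∑ i, a i := by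
  simp [transfer, sum_add_distrib]

theorem sum_range_transfer {N : ℕ} (a : Fin N → ℝ) (k l : Fin N) (t : ℝ) (j : ℕ) :
    ∑ i ∈ range j, zeroExt (transfer a k l t) i =
      ∑ i ∈ range j, zeroExt a i - (if (k : ℕ) < j then t else 0) +
        if (l : ℕ) < j then t else 0 := by
  have h : zeroExt (transfer a k l t) =
      fun i => zeroExt a i - (if i = (k : ℕ) then t else 0) + if i = (l : ℕ) then t else 0 := by
    funext i
    by_cases hi : i < N
    · simp [zeroExt, hi, transfer, Fin.ext_iff]
    · have h1 : i ≠ k := fun h => hi (h ▸ k.2)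
      have h2 : i ≠ l := fun h => hi (h ▸ l.2)
      simp [zeroExt, hi, h1, h2]
  simp [h, sum_add_distrib]

/-- A transfer that makes `a` agree with `w` at one more coordinate. -/
theorem card_transfer_lt {N : ℕ} {a w : Fin N → ℝ} {k l : Fin N} (hk : w k < a k)
    (hl : a l < w l) :
    (univ.filter fun i => transfer a k l (min (a k - w k) (w l - a l)) i ≠ w i).card <
      (univ.filter fun i => a i ≠ w i).card := by
  have hkl : k ≠ l := by
    rintro rfl
    exact lt_asymm hk hl
  refine card_lt_card ⟨fun i hi => ?_, fun hsub => ?_⟩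
  · simp only [mem_filter, mem_univ, true_and] at hi ⊢
    by_cases h1 : i = k
    · exact h1 ▸ hk.ne'
    · by_cases h2 : i = l
      · exact h2 ▸ hl.ne
      · rwa [transfer_apply_of_ne a h1 h2] at hi
  · have h1 := hsub (mem_filter.mpr ⟨mem_univ k, hk.ne'⟩)
    have h2 := hsub (mem_filter.mpr ⟨mem_univ l, hl.ne⟩)
    simp only [mem_filter, mem_univ, true_and, transfer_apply_left a hkl,
      transfer_apply_right a hkl] at h1 h2
    rcases min_choice (a k - w k) (w l - a l) with h | h
    · exact h1 (by rw [h]; ring)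
    · exact h2 (by rw [h]; ring)

/-- Closure under transfers from a larger to a smaller coordinate, not beyond exchanging them. -/
def TransferClosed {N : ℕ} (X : Set (Fin N → ℝ)) : Prop :=
  ∀ a ∈ X, ∀ k l, k ≠ l → ∀ t, 0 ≤ t → t ≤ a k - a l → transfer a k l t ∈ X

theorem TransferClosed.transfer_min_mem {N : ℕ} {X : Set (Fin N → ℝ)} (hX : TransferClosed X)
    {a w : Fin N → ℝ} (ha : a ∈ X) {k l : Fin N} (hk : w k < a k) (hl : a l < w l)
    (hw : w l ≤ w k) : transfer a k l (min (a k - w k) (w l - a l)) ∈ X := by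
  refine hX a ha k l ?_ _ (le_min (by linarith) (by linarith))
    ((min_le_left _ _).trans (by linarith))
  rintro rfl
  exact lt_asymm hk hl

/-- A non-increasing vector is reached by transfers from any vector that dominates its prefix
sums. -/
theorem TransferClosed.mem_of_prefix_le {N : ℕ} {X : Set (Fin N → ℝ)} (hX : TransferClosed X)
    {w : Fin N → ℝ} (hw : Antitone w) (s : ℕ) : ∀ a ∈ X,
    (univ.filter fun i => a i ≠ w i).card = s →
    (∀ j, ∑ i ∈ range j, zeroExt w i ≤ ∑ i ∈ range j, zeroExt a i) → ∑ i, w i = ∑ i, a i →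
    w ∈ X := by
  induction s using Nat.strong_induction_on with
  | _ s ih =>
    intro a ha hs hpre htot
    by_cases heq : a = w
    · exact heq ▸ ha
    have hex : ∃ l, a l < w l := by
      by_contra! hge
      have h1 := (sum_eq_sum_iff_of_le fun i _ => hge i).mp htot
      exact heq (funext fun i => (h1 i (mem_univ i)).symm)
    obtain ⟨l, hl, hmin⟩ : ∃ l, a l < w l ∧ ∀ i, i < l → w i ≤ a i := by
      obtain ⟨l, hl⟩ := (univ.filter fun l => a l < w l).exists_minimal (by
        obtain ⟨l, hl⟩ := hex
        exact ⟨l, by simpa using hl⟩)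
      refine ⟨l, by simpa using hl.1, fun i hi => ?_⟩
      by_contra! hlt
      exact absurd (hl.2 (by simpa using hlt) hi.le) (not_le.mpr hi)
    have hge : ∀ i < (l : ℕ), zeroExt w i ≤ zeroExt a i := fun i hi => by
      rw [zeroExt_of_lt w (hi.trans l.2), zeroExt_of_lt a (hi.trans l.2)]
      exact hmin _ hi
    -- The deficit at `l`, the first one, must be offset by an earlier surplus, since the prefix sum
    -- through `l` still dominates.
    obtain ⟨k, hkl, hk⟩ : ∃ k, k < l ∧ w k < a k := by
      by_contra! hle
      have h1 := hpre (l + 1)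
      rw [sum_range_succ, sum_range_succ, zeroExt_val, zeroExt_val] at h1
      have h2 : ∑ i ∈ range l, zeroExt a i ≤ ∑ i ∈ range l, zeroExt w i := by
        refine sum_le_sum fun i hi => ?_
        rw [mem_range] at hi
        rw [zeroExt_of_lt w (hi.trans l.2), zeroExt_of_lt a (hi.trans l.2)]
        exact hle _ hi
      linarith
    refine ih _ (hs ▸ card_transfer_lt hk hl) _ (hX.transfer_min_mem ha hk hl (hw hkl.le)) rfl
      (fun j => ?_) (by rw [sum_transfer, htot])
    rw [sum_range_transfer]
    have hkl' : (k : ℕ) < l := hkl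
    by_cases h1 : (k : ℕ) < j
    · by_cases h2 : (l : ℕ) < j
      · rw [if_pos h1, if_pos h2]
        linarith [hpre j]
      · rw [if_pos h1, if_neg h2]
        -- Before `l` there are only surpluses, so the slack of the prefix sum is at least the
        -- surplus at `k`, hence at least the amount moved.
        have h3 := single_le_sum (f := fun i => zeroExt a i - zeroExt w i) (s := range j)
          (fun i hi => sub_nonneg.mpr (hge i (by have := mem_range.mp hi; omega)))
          (mem_range.mpr h1)
        rw [sum_sub_distrib] at h3
        simp only [zeroExt_val] at h3
        linarith [min_le_left (a k - w k) (w l - a l)]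
    · rw [if_neg h1, if_neg (by omega)]
      linarith [hpre j]

/-- The constant vector is reached by transfers from any vector with the same sum. -/
theorem TransferClosed.const_mem {N : ℕ} {X : Set (Fin N → ℝ)} (hX : TransferClosed X) {c : ℝ}
    (s : ℕ) : ∀ a ∈ X, (univ.filter fun i => a i ≠ c).card = s → ∑ i, a i = N * c →
    (fun _ => c) ∈ X := by
  induction s using Nat.strong_induction_on with
  | _ s ih =>
    intro a ha hs htot
    by_cases heq : a = fun _ => c
    · exact heq ▸ ha
    obtain ⟨i, hi⟩ := Function.ne_iff.mp heq
    have h0 : ∑ i, (a i - c) = 0 := by simp [htot]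
    have h0' : ∑ i, (c - a i) = 0 := by simp [htot]
    obtain ⟨k, -, hk⟩ := exists_pos_of_sum_zero_of_exists_nonzero _ h0
      ⟨i, mem_univ i, sub_ne_zero.mpr hi⟩
    obtain ⟨l, -, hl⟩ := exists_pos_of_sum_zero_of_exists_nonzero _ h0'
      ⟨i, mem_univ i, sub_ne_zero.mpr (Ne.symm hi)⟩
    exact ih _ (hs ▸ card_transfer_lt (w := fun _ => c) (sub_pos.mp hk) (sub_pos.mp hl)) _
      (hX.transfer_min_mem (w := fun _ => c) ha (sub_pos.mp hk) (sub_pos.mp hl) le_rfl) rfl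
      (by rw [sum_transfer, htot])

/-! ### Norms of the sequences with a given frame operator -/

/-- The vectors of squared norms of the sequences of `N` vectors with frame operator `S`. -/
def frameNorms {d : ℕ} (N : ℕ) (S : Matrix (Fin d) (Fin d) ℂ) : Set (Fin N → ℝ) :=
  {a | ∃ f ∈ vecSet d a, vecFrameOp f = S}

theorem rankOne_rotate {d : ℕ} (x y : EuclideanSpace ℂ (Fin d)) {c s : ℝ}
    (h : c ^ 2 + s ^ 2 = 1) :
    rankOne ((c : ℂ) • x + (s : ℂ) • y) ((c : ℂ) • x + (s : ℂ) • y) +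
      rankOne ((-s : ℂ) • x + (c : ℂ) • y) ((-s : ℂ) • x + (c : ℂ) • y) =
      rankOne x x + rankOne y y := by
  have h' : (c : ℂ) ^ 2 + (s : ℂ) ^ 2 = 1 := by exact_mod_cast h
  ext a b
  simp only [rankOne, Matrix.add_apply, Matrix.of_apply, PiLp.add_apply, PiLp.smul_apply,
    smul_eq_mul, star_add, star_mul', star_neg, Complex.star_def, Complex.conj_ofReal]
  linear_combination (x a * (starRingEnd ℂ) (x b) + y a * (starRingEnd ℂ) (y b)) * h'

/-- Rotating `f k` and `f l` through a quarter turn moves the first squared norm continuously from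
`a k` to `a l`, so it takes the value `a k - t`; the trace fixes the other norm. -/
theorem frameNorms_transferClosed {d N : ℕ} (S : Matrix (Fin d) (Fin d) ℂ) :
    TransferClosed (frameNorms N S) := by
  rintro a ⟨f, hf, hfS⟩ k l hkl t ht0 ht
  set φ : ℝ → ℝ := fun θ =>
    ‖((Real.cos θ : ℝ) : ℂ) • f k + ((Real.sin θ : ℝ) : ℂ) • f l‖ ^ 2 with hφ
  have hcont : Continuous φ := by
    have h1 : Continuous fun θ : ℝ => ((Real.cos θ : ℝ) : ℂ) :=
      Complex.continuous_ofReal.comp Real.continuous_cos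
    have h2 : Continuous fun θ : ℝ => ((Real.sin θ : ℝ) : ℂ) :=
      Complex.continuous_ofReal.comp Real.continuous_sin
    exact ((h1.smul continuous_const).add (h2.smul continuous_const)).norm.pow 2
  have hφ0 : φ 0 = a k := by simp [hφ, hf k]
  have hφ1 : φ (Real.pi / 2) = a l := by simp [hφ, hf l]
  obtain ⟨θ, -, hθ⟩ := intermediate_value_Icc' (by positivity : (0 : ℝ) ≤ Real.pi / 2)
    hcont.continuousOn (show a k - t ∈ Set.Icc (φ (Real.pi / 2)) (φ 0) by
      rw [hφ0, hφ1]
      constructor <;> linarith)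
  set x := ((Real.cos θ : ℝ) : ℂ) • f k + ((Real.sin θ : ℝ) : ℂ) • f l with hx
  set y := (-((Real.sin θ : ℝ) : ℂ)) • f k + ((Real.cos θ : ℝ) : ℂ) • f l with hy
  have hrot : rankOne x x + rankOne y y = rankOne (f k) (f k) + rankOne (f l) (f l) :=
    rankOne_rotate _ _ (Real.cos_sq_add_sin_sq θ)
  have hxn : ‖x‖ ^ 2 = a k - t := hθ
  have hyn : ‖y‖ ^ 2 = a l + t := by
    have h1 := congrArg (frob 1) hrot
    simp only [frob_add_right, frob_one_rankOne, hf k, hf l, hxn] at h1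
    linarith
  refine ⟨fun i => if i = k then x else if i = l then y else f i, fun i => ?_, ?_⟩
  · by_cases h1 : i = k
    · subst h1
      simp only [if_pos]
      rw [hxn, transfer_apply_left a hkl]
    · by_cases h2 : i = l
      · subst h2
        simp only [if_neg h1, if_pos]
        rw [hyn, transfer_apply_right a hkl]
      · simp only [if_neg h1, if_neg h2]
        rw [hf i, transfer_apply_of_ne a h1 h2]
  · rw [← hfS, vecFrameOp, vecFrameOp, ← add_sum_erase _ _ (mem_univ k),
      ← add_sum_erase _ _ (mem_erase.mpr ⟨hkl.symm, mem_univ l⟩),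
      ← add_sum_erase univ (fun i => rankOne (f i) (f i)) (mem_univ k),
      ← add_sum_erase (univ.erase k) (fun i => rankOne (f i) (f i))
        (mem_erase.mpr ⟨hkl.symm, mem_univ l⟩), ← add_assoc, ← add_assoc]
    congr 1
    · simpa [hkl.symm] using hrot
    · refine sum_congr rfl fun i hi => ?_
      rw [mem_erase, mem_erase] at hi
      simp [hi.1, hi.2.1]

/-- Every matrix with an admissible spectrum is the frame operator of a sequence of vectors with
the prescribed norms. -/
theorem exists_vecFrameOp_eq {d N : ℕ} {w : Fin N → ℝ} (hw : Antitone w) {μ : Fin d → ℝ}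
    (hμ : IsAdmissible w μ) (v : OrthonormalBasis (Fin d) ℂ (EuclideanSpace ℂ (Fin d))) :
    ∃ f ∈ vecSet d w, vecFrameOp f = spectralSum v μ := by
  have hext : zeroExt (fun k : Fin N => zeroExt μ k) = zeroExt μ := by
    funext i
    by_cases hi : i < N
    · rw [zeroExt_of_lt _ hi]
    · rw [zeroExt_of_le _ (not_lt.mp hi), hμ.eq_zero (not_lt.mp hi)]
  have hN : ∑ i ∈ range N, zeroExt μ i = ∑ i ∈ range (min d N), zeroExt μ i :=
    sum_range_eq_of_eq_zero (min_le_right _ _) fun i h1 h2 => zeroExt_of_le μ (by omega)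
  -- Start from the vectors `√(μ k) • v k`, padded with zeros if `N > d`; if `N < d`, nothing is
  -- lost because `μ` vanishes from `N` on.
  refine (frameNorms_transferClosed (spectralSum v μ)).mem_of_prefix_le hw _
    (fun k => zeroExt μ k) ?_ rfl (fun j => ?_) ?_
  · set f : Fin N → EuclideanSpace ℂ (Fin d) := fun k =>
      if h : (k : ℕ) < d then ((√(μ ⟨k, h⟩) : ℝ) : ℂ) • v ⟨k, h⟩ else 0 with hf
    set F : ℕ → Matrix (Fin d) (Fin d) ℂ := fun i =>
      if h : i < d then (μ ⟨i, h⟩ : ℂ) • rankOne (v ⟨i, h⟩) (v ⟨i, h⟩) else 0 with hF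
    refine ⟨f, fun k => ?_, ?_⟩
    · simp only [hf, zeroExt]
      split_ifs with h
      · rw [norm_smul, v.norm_eq_one, mul_one, Complex.norm_real, Real.norm_eq_abs, sq_abs,
          Real.sq_sqrt (hμ.nonneg _)]
      · simp
    · have h1 : vecFrameOp f = ∑ k : Fin N, F k := by
        refine sum_congr rfl fun k _ => ?_
        simp only [hf, hF]
        split_ifs with h
        · have h2 : ((√(μ ⟨k, h⟩) : ℝ) : ℂ) * ((√(μ ⟨k, h⟩) : ℝ) : ℂ) = (μ ⟨k, h⟩ : ℂ) := by
            rw [← Complex.ofReal_mul, Real.mul_self_sqrt (hμ.nonneg _)]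
          ext a b
          simp only [rankOne, Matrix.of_apply, PiLp.smul_apply, smul_eq_mul, star_mul',
            Complex.star_def, Complex.conj_ofReal, Matrix.smul_apply]
          rw [← h2]
          ring
        · ext a b
          simp [rankOne]
      have h2 : spectralSum v μ = ∑ i : Fin d, F i :=
        sum_congr rfl fun i _ => by simp [hF]
      rw [h1, h2, Fin.sum_univ_eq_sum_range, Fin.sum_univ_eq_sum_range,
        sum_range_eq_of_eq_zero (F := F) (min_le_right d N),
        sum_range_eq_of_eq_zero (F := F) (min_le_left d N)]
      · intro i h3 h4
        have h5 := hμ.eq_zero (show N ≤ i by omega)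
        rw [zeroExt_of_lt μ h4] at h5
        simp [hF, h5]
      · intro i h3 h4
        simp only [hF]
        rw [dif_neg (by omega)]
  · rw [hext]
    exact hμ.prefix_le j
  · rw [Fin.sum_univ_eq_sum_range (zeroExt μ), hN, hμ.sum_min, sum_univ_eq_sum_range_zeroExt]

/-! ### The two problems have the same frame operators -/

theorem isGBessel {m n d : ℕ} (T : Fin m → Matrix (Fin n) (Fin d) ℂ) : IsGBessel T := by
  refine ⟨1 + ∑ i, ‖LinearMap.toContinuousLinearMap (Matrix.toEuclideanLin (T i))‖ ^ 2,
    by positivity, fun x => ?_⟩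
  rw [add_mul, one_mul, sum_mul]
  refine le_add_of_nonneg_of_le (by positivity) (sum_le_sum fun i _ => ?_)
  rw [← mul_pow]
  exact pow_le_pow_left₀ (norm_nonneg _)
    ((LinearMap.toContinuousLinearMap (Matrix.toEuclideanLin (T i))).le_opNorm x) 2

theorem gFrameOp_gOfVec {m n d : ℕ} (f : Fin (m * n) → EuclideanSpace ℂ (Fin d)) :
    gFrameOp (gOfVec (n := n) f) = vecFrameOp f := by
  rw [vecFrameOp, ← finProdFinEquiv.sum_comp, Fintype.sum_prod_type, gFrameOp]
  refine sum_congr rfl fun i _ => ?_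
  ext a b
  simp [gOfVec, rankOne, Matrix.mul_apply, Matrix.sum_apply]

theorem gOfVec_mem_gSet {m n d : ℕ} (hn : 0 < n) {α : Fin m → ℝ}
    {f : Fin (m * n) → EuclideanSpace ℂ (Fin d)} (hf : f ∈ vecSet d (splitWeights n α)) :
    gOfVec (n := n) f ∈ gSet n d α := by
  refine ⟨isGBessel _, fun i => ?_⟩
  have hn' : (n : ℝ) ≠ 0 := by exact_mod_cast hn.ne'
  have h1 : ‖gOfVec (n := n) f i‖ ^ 2 = ∑ j, ‖f (finProdFinEquiv (i, j))‖ ^ 2 := by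
    rw [norm_sq_eq_sum]
    refine sum_congr rfl fun j _ => ?_
    rw [EuclideanSpace.norm_sq_eq]
    simp [gOfVec]
  rw [h1, sum_congr rfl fun j _ => hf _]
  simp only [splitWeights, Equiv.symm_apply_apply]
  rw [sum_const, card_univ, Fintype.card_fin, nsmul_eq_mul]
  field_simp

/-- The frame operator of the conjugate rows of a matrix can be realized with equal norms. -/
theorem exists_equal_norm_rows {n d : ℕ} (hn : 0 < n) (M : Matrix (Fin n) (Fin d) ℂ) :
    ∃ g : Fin n → EuclideanSpace ℂ (Fin d), (∀ j, ‖g j‖ ^ 2 = ‖M‖ ^ 2 / n) ∧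
      vecFrameOp g = Mᴴ * M := by
  have hn' : (n : ℝ) ≠ 0 := by exact_mod_cast hn.ne'
  set r : Fin n → EuclideanSpace ℂ (Fin d) := fun j => WithLp.toLp 2 fun a => star (M j a) with hr
  have h1 : vecFrameOp r = Mᴴ * M := by
    ext a b
    simp [vecFrameOp, hr, rankOne, Matrix.mul_apply, Matrix.sum_apply]
  have h2 : ∑ j, ‖r j‖ ^ 2 = n * (‖M‖ ^ 2 / n) := by
    rw [mul_div_cancel₀ _ hn', norm_sq_eq_sum]
    refine sum_congr rfl fun j _ => ?_
    rw [EuclideanSpace.norm_sq_eq]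
    simp [hr]
  exact (frameNorms_transferClosed (Mᴴ * M)).const_mem _ (fun j => ‖r j‖ ^ 2)
    ⟨r, fun _ => rfl, h1⟩ rfl h2

theorem exists_vecFrameOp_eq_gFrameOp {m n d : ℕ} (hn : 0 < n) {α : Fin m → ℝ}
    {T : Fin m → Matrix (Fin n) (Fin d) ℂ} (hT : T ∈ gSet n d α) :
    ∃ f ∈ vecSet d (splitWeights n α), vecFrameOp f = gFrameOp T := by
  choose g hg hgT using fun i => exists_equal_norm_rows hn (T i)
  refine ⟨fun k => g (finProdFinEquiv.symm k).1 (finProdFinEquiv.symm k).2, fun k => ?_, ?_⟩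
  · rw [hg, hT.2, splitWeights]
  · rw [vecFrameOp, ← finProdFinEquiv.sum_comp, Fintype.sum_prod_type, gFrameOp]
    simp only [Equiv.symm_apply_apply]
    exact sum_congr rfl fun i _ => hgT i

theorem splitWeights_antitone {m n : ℕ} {α : Fin m → ℝ} (hα : Antitone α) :
    Antitone (splitWeights n α) := by
  intro k k' h
  refine div_le_div_of_nonneg_right (hα ?_) (Nat.cast_nonneg n)
  -- The block containing the index `k` is `k / n`.
  exact Nat.div_le_div_right (c := n) h

theorem splitWeights_nonneg {m n : ℕ} {α : Fin m → ℝ} (hα : ∀ i, 0 ≤ α i) (k : Fin (m * n)) :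
    0 ≤ splitWeights n α k :=
  div_nonneg (hα _) (Nat.cast_nonneg n)

theorem isOptG_iff_exists_isOptVec {m n d : ℕ} (hn : 0 < n) {α : Fin m → ℝ}
    (A : Matrix (Fin d) (Fin d) ℂ) {T : Fin m → Matrix (Fin n) (Fin d) ℂ} (hT : T ∈ gSet n d α) :
    IsOptG A α T ↔ ∃ f, IsOptVec A (splitWeights n α) f ∧ gFrameOp T = vecFrameOp f := by
  constructor
  · intro h
    obtain ⟨f, hf, hfT⟩ := exists_vecFrameOp_eq_gFrameOp hn hT
    refine ⟨f, ⟨hf, fun f' hf' => ?_⟩, hfT.symm⟩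
    rw [hfT, ← gFrameOp_gOfVec f']
    exact h.2 _ (gOfVec_mem_gSet hn hf')
  · rintro ⟨f, hf, hfT⟩
    refine ⟨hT, fun T' hT' => ?_⟩
    obtain ⟨f', hf', hfT'⟩ := exists_vecFrameOp_eq_gFrameOp hn hT'
    rw [hfT, ← hfT']
    exact hf.2 f' hf'

/-! ### The distance to the frame operators -/

section Distance

variable {d N : ℕ} {A : Matrix (Fin d) (Fin d) ℂ} (hA : A.PosSemidef) {w : Fin N → ℝ}
  {δ : Fin d → ℝ}

theorem norm_sub_eq_of_spectralSum {S : Matrix (Fin d) (Fin d) ℂ} {l : Fin d → ℝ}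
    (v : OrthonormalBasis (Fin d) ℂ (EuclideanSpace ℂ (Fin d))) (h : A = spectralSum v l)
    (hS : S = spectralSum v fun i => l i - δ i) : ‖A - S‖ = √(∑ i, δ i ^ 2) := by
  have h1 : A - S = spectralSum v δ := by
    rw [h, hS, spectralSum_sub]
    simp
  rw [h1, ← norm_spectralSum_sq v.orthonormal, Real.sqrt_sq (norm_nonneg _)]

/-- The Pythagorean inequality bounds the distance of the spectra from below, and
`spectral_distance` passes to the matrices. Equality makes both tight, giving the spectrum `spec hA
- δ` and a common ordered eigenbasis. -/
theorem sqrt_le_norm_sub_vecFrameOp (hd : 0 < d) (hw : Antitone w) (hw0 : ∀ i, 0 ≤ w i)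
    (hδ : IsSpectralDiff (spec hA) w δ) {f : Fin N → EuclideanSpace ℂ (Fin d)}
    (hf : f ∈ vecSet d w) :
    √(∑ i, δ i ^ 2) ≤ ‖A - vecFrameOp f‖ ∧
      (‖A - vecFrameOp f‖ = √(∑ i, δ i ^ 2) →
        ∃ v : OrthonormalBasis (Fin d) ℂ (EuclideanSpace ℂ (Fin d)),
          A = spectralSum v (spec hA) ∧
          vecFrameOp f = spectralSum v fun i => spec hA i - δ i) := by
  obtain ⟨u, hu⟩ := exists_eq_spectralSum hA
  have hS := vecFrameOp_posSemidef f
  obtain ⟨u', hu'⟩ := exists_eq_spectralSum hS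
  have hadm := isAdmissible_of_vecFrameOp hf u' (spec_antitone hS) (spec_nonneg hS) hu'
  have hpyth := hδ.pythagoras hd (spec_antitone hA) hw hw0 hadm
  obtain ⟨hle, heq⟩ := spectral_distance u u' (spec_antitone hA) (spec_nonneg hA)
    (spec_antitone hS) (spec_nonneg hS) hu hu' (hA.add hS)
  have hnn : 0 ≤ ∑ i, (spec hS i - (spec hA i - δ i)) ^ 2 := sum_nonneg fun i _ => sq_nonneg _
  refine ⟨Real.sqrt_le_left (norm_nonneg _) |>.mpr (by linarith), fun h => ?_⟩
  have hsq : ‖A - vecFrameOp f‖ ^ 2 = ∑ i, δ i ^ 2 := by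
    rw [h, Real.sq_sqrt (sum_nonneg fun i _ => sq_nonneg _)]
  have hspec : spec hS = fun i => spec hA i - δ i := eq_of_sum_sq_le_zero (by linarith)
  obtain ⟨v, h1, h2⟩ := heq (by linarith)
  exact ⟨v, h1, hspec ▸ h2⟩

end Distance

end GFrame

/-! ### Solution of the operator-valued approximation problem -/

theorem theorem5p2 {m n d : ℕ} (hn : 0 < n) (hd : 0 < d)
    (α : Fin m → ℝ) (hα0 : ∀ i, 0 ≤ α i) (hα : Antitone α)
    (A : Matrix (Fin d) (Fin d) ℂ) (hA : A.PosSemidef) :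
    -- a best approximant exists
    (∃ T ∈ GFrame.gSet n d α, ∀ T' ∈ GFrame.gSet n d α,
      ‖A - GFrame.gFrameOp T‖ ≤ ‖A - GFrame.gFrameOp T'‖) ∧
    -- the minimal distances of the two problems are attained and equal
    (∃ D : ℝ,
      IsLeast {D' : ℝ | ∃ T ∈ GFrame.gSet n d α, D' = ‖A - GFrame.gFrameOp T‖} D ∧
      IsLeast {D' : ℝ | ∃ f ∈ GFrame.vecSet d (GFrame.splitWeights n α),
        D' = ‖A - GFrame.vecFrameOp f‖} D) ∧
    -- optimal vector sequences give optimal G-sequences, with the same frame operator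
    (∀ f, GFrame.IsOptVec A (GFrame.splitWeights n α) f →
      GFrame.IsOptG A α (GFrame.gOfVec (n := n) f) ∧
      GFrame.gFrameOp (GFrame.gOfVec (n := n) f) = GFrame.vecFrameOp f) ∧
    -- the optimal G-sequences are those with the frame operator of an optimal vector sequence
    (∀ T ∈ GFrame.gSet n d α, GFrame.IsOptG A α T ↔
      ∃ f, GFrame.IsOptVec A (GFrame.splitWeights n α) f ∧
        GFrame.gFrameOp T = GFrame.vecFrameOp f) ∧
    -- distance and best approximants, from the spectrum of `A` and the weights
    (∃ δ : Fin d → ℝ,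
      (∀ δ', GFrame.IsSpectralDiff (GFrame.spec hA) (GFrame.splitWeights n α) δ' ↔ δ' = δ) ∧
      IsLeast {D' : ℝ | ∃ T ∈ GFrame.gSet n d α, D' = ‖A - GFrame.gFrameOp T‖}
        (Real.sqrt (∑ i, δ i ^ 2)) ∧
      ∀ T ∈ GFrame.gSet n d α, GFrame.IsOptG A α T ↔
        ∃ v : OrthonormalBasis (Fin d) ℂ (EuclideanSpace ℂ (Fin d)),
          A = ∑ i, (GFrame.spec hA i : ℂ) • GFrame.rankOne (v i) (v i) ∧
          GFrame.gFrameOp T =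
            ∑ i, ((GFrame.spec hA i - δ i : ℝ) : ℂ) • GFrame.rankOne (v i) (v i)) := by
  have hw := GFrame.splitWeights_antitone (n := n) hα
  have hw0 := GFrame.splitWeights_nonneg (n := n) hα0
  obtain ⟨δ, hδ⟩ := GFrame.exists_isSpectralDiff (GFrame.spec_antitone hA) (GFrame.spec_nonneg hA)
    hw hw0
  have hadm := (hδ.optimal hd (GFrame.spec_antitone hA) hw hw0).1
  obtain ⟨u, hu⟩ := GFrame.exists_eq_spectralSum hA
  -- The spectrum `spec hA - δ` placed in an eigenbasis of `A` attains the lower bound, for the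
  -- vectors and for their blocks alike.
  obtain ⟨f₀, hf₀, hf₀S⟩ := GFrame.exists_vecFrameOp_eq hw hadm u
  have hf₀D := GFrame.norm_sub_eq_of_spectralSum u hu hf₀S
  have hT₀ := GFrame.gOfVec_mem_gSet hn hf₀
  have hlow : ∀ T ∈ GFrame.gSet n d α, √(∑ i, δ i ^ 2) ≤ ‖A - GFrame.gFrameOp T‖ := by
    intro T hT
    obtain ⟨f, hf, hfT⟩ := GFrame.exists_vecFrameOp_eq_gFrameOp hn hT
    rw [← hfT]
    exact (GFrame.sqrt_le_norm_sub_vecFrameOp hA hd hw hw0 hδ hf).1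
  have hT₀D : ‖A - GFrame.gFrameOp (GFrame.gOfVec (n := n) f₀)‖ = √(∑ i, δ i ^ 2) := by
    rw [GFrame.gFrameOp_gOfVec, hf₀D]
  have hleast : IsLeast {D' : ℝ | ∃ T ∈ GFrame.gSet n d α, D' = ‖A - GFrame.gFrameOp T‖}
      (√(∑ i, δ i ^ 2)) := by
    refine ⟨⟨_, hT₀, hT₀D.symm⟩, ?_⟩
    rintro D' ⟨T, hT, rfl⟩
    exact hlow T hT
  refine ⟨⟨_, hT₀, fun T' hT' => hT₀D.le.trans (hlow T' hT')⟩, ⟨_, hleast, ⟨f₀, hf₀, hf₀D.symm⟩, ?_⟩,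
    fun f hf => ⟨?_, GFrame.gFrameOp_gOfVec f⟩,
    fun T hT => GFrame.isOptG_iff_exists_isOptVec hn A hT, δ, fun δ' => ⟨fun h => ?_, ?_⟩,
    hleast, fun T hT => ⟨fun h => ?_, ?_⟩⟩
  · rintro D' ⟨f, hf, rfl⟩
    exact (GFrame.sqrt_le_norm_sub_vecFrameOp hA hd hw hw0 hδ hf).1
  · exact (GFrame.isOptG_iff_exists_isOptVec hn A (GFrame.gOfVec_mem_gSet hn hf.1)).mpr
      ⟨f, hf, GFrame.gFrameOp_gOfVec f⟩
  · exact hδ.unique hd (GFrame.spec_antitone hA) hw hw0 h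
  · rintro rfl
    exact hδ
  · obtain ⟨f, hf, hfT⟩ := GFrame.exists_vecFrameOp_eq_gFrameOp hn hT
    obtain ⟨v, h1, h2⟩ := (GFrame.sqrt_le_norm_sub_vecFrameOp hA hd hw hw0 hδ hf).2
      (le_antisymm (by rw [hfT]; exact (h.2 _ hT₀).trans hT₀D.le) (by rw [hfT]; exact hlow T hT))
    exact ⟨v, h1, hfT.symm.trans h2⟩
  · rintro ⟨v, h1, h2⟩
    refine ⟨hT, fun T' hT' => ?_⟩
    rw [GFrame.norm_sub_eq_of_spectralSum v h1 h2]
    exact hlow T' hT'
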